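/- Let $\mathbb D$ be the open unit disc and $\|p\|_{\infty,\mathbb D}=\sup_{z\in\mathbb D}|p(z)|$. A bounded linear operator $T$ on a complex Hilbert space $X$ is called Tadmor–Ritt if $\sigma(T)\subset\overline{\mathbb D}$ and $$C(T):=\sup_{|z|>1}\|(z-1)(zI-T)^{-1}\|<\infty .$$ For such $T$ the quantities $$Pb(T):=\sup_{n\ge1}\|T^n\|,\qquad c_{1,T}:=\sup_{n\ge1}\|n(T^n-T^{n-1})\|$$ are finite, and $c_{1,T}\neq0$ unless $T=I$. We say that an operator $S$ satisfies square function estimates with constant $K>0$ if $$\sum_{k=1}^\infty k\,\|S^kx-S^{k-1}x\|^2\le K^2\|x\|^2\qquad\text{for all } x\in X .$$ **Theorem.** For every Tadmor–Ritt operator $T\neq I$ on a complex Hilbert space $X$ there is a constant $c>0$, depending only on $C(T)$ (and not otherwise on $X$ or $T$), such that the following holds. If $T$ or its adjoint $T^*$ satisfies square function estimates with constant $K>0$, then for all integers $0\le m\le n$ and all polynomials $p(z)=\sum_{j=m}^n a_jz^j$ with complex coefficients, $$\|p(T)\|\le a\,c\,K\,e^{1/2}\,\sqrt{b+\log\tfrac{n+2}{m+1}}\;\|p\|_{\infty,\mathbb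 D},$$ where $a=\sqrt2\,c_{1,T}$ and $b=1+\dfrac{Pb(T)^2}{c_{1,T}^2}$. -/

import Mathlib

open Polynomial

universe u

noncomputable section

/-- The set of all numbers `‖(z - 1) R(z, T)‖` with `|z| > 1`, where `R(z, T) = (z I - T)⁻¹`. -/
def tadmorRittSet {X : Type*} [NormedAddCommGroup X] [NormedSpace ℂ X] (T : X →L[ℂ] X) : Set ℝ :=
  (fun z : ℂ => ‖(z - 1) • resolvent T z‖) '' {z : ℂ | 1 < ‖z‖}

/-- `T` is a Tadmor--Ritt operator: `σ(T)` lies in the closed unit disc and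
`C(T) = sup_{|z| > 1} ‖(z - 1) R(z, T)‖` is finite. -/
def IsTadmorRitt {X : Type*} [NormedAddCommGroup X] [NormedSpace ℂ X] (T : X →L[ℂ] X) : Prop :=
  spectrum ℂ T ⊆ Metric.closedBall (0 : ℂ) 1 ∧ BddAbove (tadmorRittSet T)

/-- `C(T) = sup_{|z| > 1} ‖(z - 1) R(z, T)‖`. -/
def tadmorRittConst {X : Type*} [NormedAddCommGroup X] [NormedSpace ℂ X] (T : X →L[ℂ] X) : ℝ :=
  sSup (tadmorRittSet T)

/-- `Pb(T) = sup_{n ≥ 1} ‖T ^ n‖`; the supremum is finite for every Tadmor--Ritt operator. -/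
def powerBound {X : Type*} [NormedAddCommGroup X] [NormedSpace ℂ X] (T : X →L[ℂ] X) : ℝ :=
  ⨆ n : ℕ, ‖T ^ (n + 1)‖

/-- `c_{1,T} = sup_{n ≥ 1} ‖n (T ^ n - T ^ (n - 1))‖`; the supremum is finite for every
Tadmor--Ritt operator. -/
def powerDiffBound {X : Type*} [NormedAddCommGroup X] [NormedSpace ℂ X] (T : X →L[ℂ] X) : ℝ :=
  ⨆ n : ℕ, ‖((n : ℂ) + 1) • (T ^ (n + 1) - T ^ n)‖

/-- `T` satisfies square function estimates with constant `K > 0`: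
`∑_{k ≥ 1} k ‖T ^ k x - T ^ (k - 1) x‖ ^ 2 ≤ K ^ 2 ‖x‖ ^ 2` for all `x`
(the index `k ≥ 1` is written `k + 1`). -/
def SquareFunctionEstimate {X : Type*} [NormedAddCommGroup X] [NormedSpace ℂ X]
    (T : X →L[ℂ] X) (K : ℝ) : Prop :=
  0 < K ∧ ∀ x : X,
    Summable (fun k : ℕ => ((k : ℝ) + 1) * ‖(T ^ (k + 1)) x - (T ^ k) x‖ ^ 2) ∧
    ∑' k : ℕ, ((k : ℝ) + 1) * ‖(T ^ (k + 1)) x - (T ^ k) x‖ ^ 2 ≤ K ^ 2 * ‖x‖ ^ 2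

/-- The supremum norm of a polynomial over the open unit disc. -/
def discSupNorm (p : ℂ[X]) : ℝ :=
  sSup ((fun z : ℂ => ‖p.eval z‖) '' Metric.ball (0 : ℂ) 1)

/-- The constant `a = √2 c_{1,T}`. -/
def constA {X : Type*} [NormedAddCommGroup X] [NormedSpace ℂ X] (T : X →L[ℂ] X) : ℝ :=
  Real.sqrt 2 * powerDiffBound T

/-- The constant `b = 1 + Pb(T) ^ 2 / c_{1,T} ^ 2`; it is meaningful when `c_{1,T} ≠ 0`, that is,
when `T` is not the identity. -/
def constB {X : Type*} [NormedAddCommGroup X] [NormedSpace ℂ X] (T : X →L[ℂ] X) : ℝ :=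
  1 + powerBound T ^ 2 / powerDiffBound T ^ 2

end

/-! ### Circle means of scalar kernels. -/

section CircleAverage

open Real

/-! The proof is a Littlewood–Paley decomposition over the dyadic scales N = 2^i. Telescoping
`lowPass (2 ^ i)` writes p(T) as two end pieces plus bands Y_i T^N (1 - T^N)
(`aeval_eq_band_decomposition`). The square function estimate bounds ∑ ‖T^N (1 - T^N) x‖² by K² ‖x‖²
(`SquareFunctionEstimate.sum_norm_dyadic_sq_le`), so by Cauchy–Schwarz the bands cost K (∑
‖Y_i‖²)^(1/2).

The Y_i are controlled by resolvent integrals alone. A factor 1 - X cancels the singularity of the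
resolvent at 1, so ((1 - X) g)(T) is bounded by C(T) times the L¹ norm of g on the circle; in a
band, g is dominated by a Fejér kernel, which gives ‖Y_i‖ ≲ ‖p‖. Splitting X^m off p and using ‖(1 -
T) T^m‖ ≲ 1/(m+1) gives also ‖Y_i‖ ≲ ‖p‖ 2^i/(m+1). Summing min(1, 2^i/(m+1))² up to 2^i of size n
produces the logarithm. The end pieces are ≲ ‖p‖: the lower one contains 1 - X, and for the upper
one deg p ≤ N lets the contour move out to radius 1 + 1/N at bounded cost.

The end pieces carry neither K nor c_{1,T}, but T ≠ 1 forces both constants to be at least 1/8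
(`eq_one_of_norm_dyadic_le`), so they are absorbed into the product. The case of T* follows by
taking adjoints. -/

theorem norm_circleAverage_le {E : Type*} [NormedAddCommGroup E] [NormedSpace ℝ E]
    (f : ℂ → E) (c : ℂ) (R : ℝ) :
    ‖circleAverage f c R‖ ≤ circleAverage (fun z => ‖f z‖) c R := by
  rw [circleAverage, circleAverage, norm_smul, smul_eq_mul, Real.norm_eq_abs,
    abs_of_pos (inv_pos.2 two_pi_pos)]
  exact mul_le_mul_of_nonneg_left
    (intervalIntegral.norm_integral_le_integral_norm two_pi_pos.le) (inv_pos.2 two_pi_pos).le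

/-- Parseval's identity for the geometric sum on the circle of radius `r`. -/
theorem circleAverage_norm_geom_sum_sq (N : ℕ) (r : ℝ) :
    circleAverage (fun z : ℂ => ‖∑ j ∈ Finset.range N, z ^ j‖ ^ 2) 0 r =
      ∑ j ∈ Finset.range N, (r ^ 2) ^ j := by
  rw [circleAverage_eq_circleAverage_zero_one]
  set q : ℂ[X] := ∑ j ∈ Finset.range N, C ((r : ℂ) ^ j) * X ^ j with hq
  have hc : ∀ i, q.coeff i = if i < N then (r : ℂ) ^ i else 0 := by
    intro i
    simp [hq, finsetSum_coeff, coeff_C_mul, coeff_X_pow, -map_pow]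
  have := sum_sq_norm_coeff_eq_circleAverage q
  have h2 : ∀ z : ℂ, ∑ j ∈ Finset.range N, ((r : ℂ) * z + 0) ^ j = q.eval z := by
    intro z
    simp [hq, eval_finsetSum, mul_pow]
  simp_rw [h2]
  rw [← this]
  have h3 : q.support ⊆ Finset.range N := by
    intro i hi
    rw [mem_support_iff, hc] at hi
    by_contra h
    simp_all
  rw [Finset.sum_subset h3]
  · refine Finset.sum_congr rfl fun i hi => ?_
    rw [hc, if_pos (Finset.mem_range.1 hi), norm_pow, Complex.norm_real, ← pow_mul, mul_comm,
      pow_mul]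
    simp
  · intro i _ hi
    simp only [mem_support_iff, not_not] at hi
    simp [hi]

theorem sub_one_ne_zero_of_norm_eq {r : ℝ} (hr : 1 < r) {z : ℂ} (hz : ‖z‖ = r) : z - 1 ≠ 0 := by
  intro h
  rw [sub_eq_zero] at h
  rw [h, norm_one] at hz
  exact hr.ne hz

theorem continuousOn_sub_one_inv {r : ℝ} (hr : 1 < r) :
    ContinuousOn (fun z : ℂ => (z - 1)⁻¹) (Metric.sphere 0 r) := by
  refine ContinuousOn.inv₀ (by fun_prop) fun z hz => ?_
  exact sub_one_ne_zero_of_norm_eq hr (mem_sphere_zero_iff_norm.1 hz)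

theorem circleAverage_sub_one_inv {r : ℝ} (hr : 1 < r) :
    circleAverage (fun z : ℂ => (z - 1)⁻¹) 0 r = 0 := by
  have hr0 : 0 < r := by linarith
  rw [circleAverage_eq_circleIntegral hr0.ne']
  have e : Set.EqOn (fun z : ℂ => (z - 0)⁻¹ • (z - 1)⁻¹)
      (fun z => (z - 1)⁻¹ - (z - 0)⁻¹) (Metric.sphere 0 r) := by
    intro z hz
    have h1 := sub_one_ne_zero_of_norm_eq hr (mem_sphere_zero_iff_norm.1 hz)
    have h0 : z ≠ 0 := by
      rintro rfl
      simp at hz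
      exact hr0.ne hz
    simp only [sub_zero, smul_eq_mul]
    field_simp
    ring
  rw [circleIntegral.integral_congr hr0.le e, circleIntegral.integral_sub,
    circleIntegral.integral_sub_inv_of_mem_ball (by simpa using hr),
    circleIntegral.integral_sub_center_inv _ hr0.ne', sub_self, smul_zero]
  · exact (continuousOn_sub_one_inv hr).circleIntegrable hr0.le
  · refine ContinuousOn.circleIntegrable hr0.le (ContinuousOn.inv₀ (by fun_prop) fun z hz => ?_)
    rintro h
    rw [sub_zero] at h
    simp [h] at hz
    exact hr0.ne hz

theorem circleAverage_norm_sub_one_inv_sq {r : ℝ} (hr : 1 < r) :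
    circleAverage (fun z : ℂ => ‖(z - 1)⁻¹‖ ^ 2) 0 r = (r ^ 2 - 1)⁻¹ := by
  have hr0 : 0 < r := by linarith
  have hi : CircleIntegrable (fun z : ℂ => (z - 1)⁻¹) 0 r :=
    (continuousOn_sub_one_inv hr).circleIntegrable hr0.le
  have e : Set.EqOn (fun z : ℂ => ‖(z - 1)⁻¹‖ ^ 2)
      (fun z => (r ^ 2 - 1)⁻¹ * (1 + 2 * ((z - 1)⁻¹).re)) (Metric.sphere 0 |r|) := by
    intro z hz
    rw [abs_of_pos hr0] at hz
    have hz' := mem_sphere_zero_iff_norm.1 hz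
    have h1 := sub_one_ne_zero_of_norm_eq hr hz'
    -- Taking norms, w = (z - 1)⁻¹ satisfies r²|w|² = |1 + w|², so |w|² is affine in Re w, and w has
    -- mean zero.
    have h3 : z * (z - 1)⁻¹ = 1 + (z - 1)⁻¹ := by
      field_simp
      ring
    have h4 : r ^ 2 * ‖(z - 1)⁻¹‖ ^ 2 = ‖1 + (z - 1)⁻¹‖ ^ 2 := by
      rw [← h3, norm_mul, hz', mul_pow]
    have h5 : ‖1 + (z - 1)⁻¹‖ ^ 2 = 1 + 2 * ((z - 1)⁻¹).re + ‖(z - 1)⁻¹‖ ^ 2 := by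
      rw [Complex.sq_norm, Complex.sq_norm, Complex.normSq_apply, Complex.normSq_apply]
      simp only [Complex.add_re, Complex.one_re, Complex.add_im, Complex.one_im]
      ring
    have h6 : (r ^ 2 - 1) ≠ 0 := by nlinarith
    simp only
    rw [eq_inv_mul_iff_mul_eq₀ h6]
    linarith
  rw [circleAverage_congr_sphere e]
  have h7 : circleAverage (fun z : ℂ => ((z - 1)⁻¹).re) 0 r = 0 := by
    have := (Complex.reCLM.circleAverage_comp_comm hi)
    rw [circleAverage_sub_one_inv hr] at this
    simpa [Function.comp_def] using this
  have h8 : CircleIntegrable (fun z : ℂ => ((z - 1)⁻¹).re) 0 r :=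
    (Complex.continuous_re.comp_continuousOn (continuousOn_sub_one_inv hr)).circleIntegrable hr0.le
  have h9 := circleAverage_fun_smul (𝕜 := ℝ) (a := (r ^ 2 - 1)⁻¹) (c := 0) (R := r)
    (f := fun z : ℂ => 1 + 2 * ((z - 1)⁻¹).re)
  have h10 := circleAverage_fun_smul (𝕜 := ℝ) (a := 2) (c := 0) (R := r)
    (f := fun z : ℂ => ((z - 1)⁻¹).re)
  simp only [smul_eq_mul] at h9 h10
  have h11 : CircleIntegrable (fun z : ℂ => 2 * ((z - 1)⁻¹).re) 0 r :=
    h8.const_smul (a := (2 : ℝ))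
  rw [h9, circleAverage_fun_add (circleIntegrable_const _ _ _) h11, circleAverage_const, h10, h7]
  simp

end CircleAverage

/-! ### Resolvent calculus under the Ritt condition. -/

section Ritt

open Real

variable {A : Type*} [NormedRing A] [NormedAlgebra ℂ A]

/-- The element `a` of a Banach algebra satisfies the Ritt resolvent condition with constant `C`. -/
structure RittCondition (a : A) (C : ℝ) : Prop where
  mem_resolventSet : ∀ z : ℂ, 1 < ‖z‖ → z ∈ resolventSet ℂ a
  norm_le : ∀ z : ℂ, 1 < ‖z‖ → ‖z - 1‖ * ‖resolvent a z‖ ≤ C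

namespace RittCondition

variable {a : A} {C : ℝ}

theorem sub_mul_resolvent (h : RittCondition a C) {z : ℂ} (hz : 1 < ‖z‖) :
    (algebraMap ℂ A z - a) * resolvent a z = 1 :=
  Ring.mul_inverse_cancel _ (h.mem_resolventSet z hz)

theorem smul_resolvent (h : RittCondition a C) {z : ℂ} (hz : 1 < ‖z‖) :
    z • resolvent a z = 1 + a * resolvent a z := by
  have := h.sub_mul_resolvent hz
  rw [sub_mul, sub_eq_iff_eq_add, ← Algebra.smul_def] at this
  exact this

theorem one_sub_mul_resolvent (h : RittCondition a C) {z : ℂ} (hz : 1 < ‖z‖) :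
    (1 - a) * resolvent a z = 1 - (z - 1) • resolvent a z := by
  rw [sub_smul, h.smul_resolvent hz, sub_mul, one_mul, one_smul]
  abel

theorem norm_resolvent_le (h : RittCondition a C) {z : ℂ} (hz : 1 < ‖z‖) :
    ‖resolvent a z‖ ≤ C * ‖(z - 1)⁻¹‖ := by
  have h1 := sub_one_ne_zero_of_norm_eq hz rfl
  rw [norm_inv, ← div_eq_mul_inv, le_div_iff₀ (norm_pos_iff.2 h1), mul_comm]
  exact h.norm_le z hz

theorem nonneg (h : RittCondition a C) : 0 ≤ C :=
  (by positivity : 0 ≤ ‖(2 : ℂ) - 1‖ * ‖resolvent a (2 : ℂ)‖).trans (h.norm_le 2 (by simp))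

variable [CompleteSpace A]

theorem hasDerivAt_resolvent (h : RittCondition a C) {z : ℂ} (hz : 1 < ‖z‖) :
    HasDerivAt (resolvent a) (-resolvent a z ^ 2) z :=
  spectrum.hasDerivAt_resolvent_const_left (h.mem_resolventSet z hz)

theorem continuousOn_resolvent (h : RittCondition a C) {r : ℝ} (hr : 1 < r) :
    ContinuousOn (resolvent a) (Metric.sphere (0 : ℂ) r) := fun z hz =>
  (h.hasDerivAt_resolvent (by rwa [mem_sphere_zero_iff_norm.1 hz])).continuousAt.continuousWithinAt

theorem circleIntegrable_smul_resolvent (h : RittCondition a C) {r : ℝ} (hr : 1 < r)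
    {f : ℂ → ℂ} (hf : Continuous f) : CircleIntegrable (fun z => f z • resolvent a z) 0 r :=
  (hf.continuousOn.smul (h.continuousOn_resolvent hr)).circleIntegrable (by linarith)

/-- By Cauchy's theorem on an annulus the mean does not depend on the radius R, and the Ritt bound
makes it at most C/(R - 1), which tends to 0. -/
theorem circleAverage_resolvent (h : RittCondition a C) {r : ℝ} (hr : 1 < r) :
    circleAverage (resolvent a) (0 : ℂ) r = 0 := by
  have hr0 : 0 < r := by linarith
  have indep : ∀ R, r ≤ R → circleAverage (resolvent a) (0 : ℂ) R
      = circleAverage (resolvent a) (0 : ℂ) r := by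
    intro R hR
    rw [circleAverage_eq_circleIntegral hr0.ne',
      circleAverage_eq_circleIntegral (hr0.trans_le hR).ne']
    congr 1
    refine Complex.circleIntegral_eq_of_differentiable_on_annulus_off_countable hr0 hR
      Set.countable_empty ?_ ?_
    · intro z hz
      have hz' : r ≤ ‖z‖ := by simpa using hz.2
      have hz0 : z - 0 ≠ 0 := by
        rw [sub_zero, ← norm_pos_iff]
        linarith
      exact ((by fun_prop (disch := exact hz0) : ContinuousAt (fun z : ℂ => (z - 0)⁻¹) z).smul
        (h.hasDerivAt_resolvent (by linarith)).continuousAt).continuousWithinAt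
    · intro z hz
      have hz' : r < ‖z‖ := by simpa using hz.1.2
      have hz0 : z - 0 ≠ 0 := by
        rw [sub_zero, ← norm_pos_iff]
        linarith
      exact (by fun_prop (disch := exact hz0) : DifferentiableAt ℂ (fun z : ℂ => (z - 0)⁻¹) z).smul
        (h.hasDerivAt_resolvent (by linarith)).differentiableAt
  have bound : ∀ R, r ≤ R → ‖circleAverage (resolvent a) (0 : ℂ) r‖ ≤ C * (R - 1)⁻¹ := by
    intro R hR
    have hR1 : 1 < R := hr.trans_le hR
    rw [← indep R hR]
    refine (norm_circleAverage_le _ _ _).trans (circleAverage_mono_on_of_le_circle ?_ ?_)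
    · exact (h.continuousOn_resolvent hR1).norm.circleIntegrable (by linarith)
    · intro z hz
      rw [abs_of_pos (by linarith), mem_sphere_zero_iff_norm] at hz
      refine (h.norm_resolvent_le (by linarith)).trans ?_
      have := norm_sub_norm_le z 1
      rw [norm_one, hz] at this
      rw [norm_inv]
      exact mul_le_mul_of_nonneg_left (inv_anti₀ (by linarith) this) h.nonneg
  have lim : Filter.Tendsto (fun R : ℝ => C * (R - 1)⁻¹) Filter.atTop (nhds (C * 0)) :=
    (tendsto_inv_atTop_zero.comp (Filter.tendsto_atTop_add_const_right _ (-1)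
      Filter.tendsto_id)).const_mul C
  rw [mul_zero] at lim
  refine norm_le_zero_iff.1 (ge_of_tendsto lim ?_)
  filter_upwards [Filter.eventually_ge_atTop r] with R hR using bound R hR

/-- Induction through z R(z) = 1 + a R(z). The exponent is n + 1 because a circle mean integrates
against dz/z. -/
theorem circleAverage_pow_smul_resolvent (h : RittCondition a C) {r : ℝ} (hr : 1 < r) (n : ℕ) :
    circleAverage (fun z => z ^ (n + 1) • resolvent a z) (0 : ℂ) r = a ^ n := by
  have hr0 : 0 < r := by linarith
  have step : ∀ n : ℕ, circleAverage (fun z => z ^ (n + 1) • resolvent a z) (0 : ℂ) r =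
      circleAverage (fun z => z ^ n • (1 : A)) (0 : ℂ) r +
        a * circleAverage (fun z => z ^ n • resolvent a z) (0 : ℂ) r := by
    intro n
    have hi := h.circleIntegrable_smul_resolvent hr (f := fun z => z ^ n) (by fun_prop)
    have hL := (ContinuousLinearMap.mul ℝ A a).circleAverage_comp_comm hi
    simp only [Function.comp_def, ContinuousLinearMap.mul_apply'] at hL
    rw [← hL, ← circleAverage_fun_add]
    · refine circleAverage_congr_sphere fun z hz => ?_
      rw [abs_of_pos hr0, mem_sphere_zero_iff_norm] at hz
      rw [pow_succ, mul_smul, h.smul_resolvent (by linarith), smul_add, mul_smul_comm]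
    · exact ContinuousOn.circleIntegrable hr0.le (by fun_prop)
    · exact ((continuous_pow n).continuousOn.smul (h.continuousOn_resolvent hr)).const_mul a
        |>.circleIntegrable hr0.le
  have const : ∀ n : ℕ, circleAverage (fun z : ℂ => z ^ n • (1 : A)) (0 : ℂ) r =
      if n = 0 then 1 else 0 := by
    intro n
    have hd : DiffContOnCl ℂ (fun z : ℂ => z ^ n • (1 : A)) (Metric.ball 0 |r|) :=
      Differentiable.diffContOnCl (by fun_prop)
    rw [hd.circleAverage]
    split_ifs with hn <;> simp [hn]
  induction n with
  | zero =>
    rw [step, const]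
    simp [h.circleAverage_resolvent hr]
  | succ n ih => rw [step, const, ih, pow_succ']; simp

theorem circleAverage_eval_smul_resolvent (h : RittCondition a C) {r : ℝ} (hr : 1 < r) (q : ℂ[X]) :
    circleAverage (fun z => (z * q.eval z) • resolvent a z) (0 : ℂ) r = aeval a q := by
  induction q using Polynomial.induction_on' with
  | add p q hp hq =>
    rw [map_add, ← hp, ← hq, ← circleAverage_fun_add
      (h.circleIntegrable_smul_resolvent hr (by fun_prop))
      (h.circleIntegrable_smul_resolvent hr (by fun_prop))]
    simp only [eval_add, mul_add, add_smul]
  | monomial n c =>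
    rw [aeval_monomial, ← h.circleAverage_pow_smul_resolvent hr n, ← Algebra.smul_def,
      ← circleAverage_fun_smul]
    congr 1
    ext z
    rw [eval_monomial, smul_smul]
    congr 1
    ring

theorem norm_aeval_le (h : RittCondition a C) {r : ℝ} (hr : 1 < r) (q : ℂ[X]) :
    ‖aeval a q‖ ≤ r * C * circleAverage (fun z => ‖q.eval z‖ * ‖(z - 1)⁻¹‖) (0 : ℂ) r := by
  have hr0 : 0 < r := by linarith
  rw [← h.circleAverage_eval_smul_resolvent hr, ← smul_eq_mul (r * C), ← circleAverage_fun_smul]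
  refine (norm_circleAverage_le _ _ _).trans (circleAverage_mono ?_ ?_ ?_)
  · exact (((continuous_id.mul q.continuous).continuousOn.smul
      (h.continuousOn_resolvent hr)).norm).circleIntegrable hr0.le
  · refine ContinuousOn.circleIntegrable hr0.le ?_
    exact continuousOn_const.mul (q.continuous.norm.continuousOn.mul
      (continuousOn_sub_one_inv hr).norm)
  · intro z hz
    rw [abs_of_pos hr0, mem_sphere_zero_iff_norm] at hz
    rw [norm_smul, norm_mul, hz, smul_eq_mul]
    calc r * ‖q.eval z‖ * ‖resolvent a z‖ ≤ r * ‖q.eval z‖ * (C * ‖(z - 1)⁻¹‖) := by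
          gcongr
          exact h.norm_resolvent_le (by linarith)
      _ = _ := by ring

/-- The Ritt condition bounds `(1 - a) g(a)` by the `L¹` norm of `g` on the unit circle. -/
theorem norm_aeval_one_sub_mul_le (h : RittCondition a C) (g : ℂ[X]) :
    ‖aeval a ((1 - X) * g)‖ ≤ C * circleAverage (fun z => ‖g.eval z‖) (0 : ℂ) 1 := by
  -- On each larger circle the factor 1 - z cancels |z - 1|⁻¹ exactly; the right side is continuous
  -- in r, so r can tend to 1.
  have key : ∀ r : ℝ, 1 < r → ‖aeval a ((1 - X) * g)‖ ≤
      r * C * circleAverage (fun z => ‖g.eval z‖) (0 : ℂ) r := by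
    intro r hr
    refine (h.norm_aeval_le hr _).trans (le_of_eq ?_)
    congr 1
    refine circleAverage_congr_sphere fun z hz => ?_
    rw [abs_of_pos (by linarith), mem_sphere_zero_iff_norm] at hz
    have h1 := norm_pos_iff.2 (sub_one_ne_zero_of_norm_eq hr hz)
    simp only [eval_mul, eval_sub, eval_one, eval_X, norm_mul, norm_inv]
    rw [norm_sub_rev]
    field_simp
  have cont : Continuous fun r : ℝ => r * C * circleAverage (fun z => ‖g.eval z‖) (0 : ℂ) r := by
    have : Continuous fun z => ‖g.eval z‖ := g.continuous.norm
    fun_prop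
  have lim := (cont.tendsto 1).mono_left (nhdsWithin_le_nhds (s := Set.Ioi 1))
  rw [one_mul] at lim
  refine ge_of_tendsto lim ?_
  filter_upwards [self_mem_nhdsWithin] with r hr using key r hr

end RittCondition
end Ritt

/-! ### Decay of power differences, and rigidity of small ones. -/

section PowerDifferences

open Real

theorem one_add_inv_pow_le {n : ℕ} {N : ℕ} (hN : 0 < N) (hn : n ≤ N) :
    (1 + (N : ℝ)⁻¹) ^ n ≤ 3 := by
  have hN' : (0 : ℝ) < N := by exact_mod_cast hN
  calc (1 + (N : ℝ)⁻¹) ^ n ≤ (1 + (N : ℝ)⁻¹) ^ N :=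
        pow_le_pow_right₀ (by have := inv_pos.2 hN'; linarith) hn
    _ ≤ (Real.exp (N : ℝ)⁻¹) ^ N := by
        gcongr
        rw [add_comm]
        exact Real.add_one_le_exp _
    _ = Real.exp 1 := by rw [← Real.exp_nat_mul, mul_inv_cancel₀ hN'.ne']
    _ ≤ 3 := Real.exp_one_lt_three.le

theorem sq_one_add_inv_sub_one_inv_le {N : ℕ} (hN : 0 < N) :
    ((1 + (N : ℝ)⁻¹) ^ 2 - 1)⁻¹ ≤ (N : ℝ) / 2 := by
  have hN' : (0 : ℝ) < N := by exact_mod_cast hN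
  rw [show (N : ℝ) / 2 = (2 * (N : ℝ)⁻¹)⁻¹ by field_simp]
  refine inv_anti₀ (by positivity) ?_
  nlinarith [sq_nonneg (N : ℝ)⁻¹]

theorem circleAverage_smul_deriv_eq_zero {E : Type*} [NormedAddCommGroup E] [NormedSpace ℂ E]
    [CompleteSpace E] {F F' : ℂ → E} {r : ℝ} (hr : 0 < r)
    (hF : ∀ z : ℂ, ‖z‖ = r → HasDerivAt F (F' z) z) :
    circleAverage (fun z => z • F' z) 0 r = 0 := by
  rw [circleAverage_eq_circleIntegral hr.ne']
  have e : Set.EqOn (fun z : ℂ => (z - 0)⁻¹ • z • F' z) F' (Metric.sphere 0 r) := by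
    intro z hz
    have h0 : z ≠ 0 := by
      rintro rfl
      simp at hz
      exact hr.ne hz
    simp only [sub_zero, smul_smul, inv_mul_cancel₀ h0, one_smul]
  rw [circleIntegral.integral_congr hr.le e,
    circleIntegral.integral_eq_zero_of_hasDerivWithinAt hr.le
      fun z hz => (hF z (mem_sphere_zero_iff_norm.1 hz)).hasDerivWithinAt, smul_zero]

namespace RittCondition

variable {A : Type*} [NormedRing A] [NormedAlgebra ℂ A] [CompleteSpace A] {a : A} {C : ℝ}

theorem circleIntegrable_smul_resolvent_pow (h : RittCondition a C) {r : ℝ} (hr : 1 < r)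
    (c : ℂ) (m k : ℕ) :
    CircleIntegrable (fun z => (c * z ^ m) • resolvent a z ^ k) 0 r := by
  refine ContinuousOn.circleIntegrable (by linarith) ?_
  have h1 : Continuous fun z : ℂ => c * z ^ m := by fun_prop
  exact h1.continuousOn.smul ((h.continuousOn_resolvent hr).pow k)

/-- Integration by parts: z F'(z) has mean zero for F = z^(n+1) R(z), and R' = -R². -/
theorem circleAverage_resolvent_sq (h : RittCondition a C) {r : ℝ} (hr : 1 < r) (n : ℕ) :
    circleAverage (fun z => z ^ (n + 2) • resolvent a z ^ 2) (0 : ℂ) r = ((n : ℂ) + 1) • a ^ n := by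
  have hr0 : 0 < r := by linarith
  have hd : ∀ z : ℂ, ‖z‖ = r → HasDerivAt (fun z => z ^ (n + 1) • resolvent a z)
      (z ^ (n + 1) • -resolvent a z ^ 2 + (((n + 1 : ℕ) : ℂ) * z ^ n) • resolvent a z) z := by
    intro z hz
    exact (hasDerivAt_pow (n + 1) z).smul (h.hasDerivAt_resolvent (by linarith))
  have h0 := circleAverage_smul_deriv_eq_zero hr0 hd
  have e : (fun z : ℂ => z • (z ^ (n + 1) • -resolvent a z ^ 2 +
      (((n + 1 : ℕ) : ℂ) * z ^ n) • resolvent a z)) =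
      fun z => (((n : ℂ) + 1) * z ^ (n + 1)) • resolvent a z ^ 1
        - (1 * z ^ (n + 2)) • resolvent a z ^ 2 := by
    ext z
    rw [pow_one]
    push_cast
    module
  rw [e, circleAverage_fun_sub (h.circleIntegrable_smul_resolvent_pow hr _ _ _)
    (h.circleIntegrable_smul_resolvent_pow hr _ _ _), sub_eq_zero] at h0
  simp only [one_mul, pow_one, mul_smul] at h0
  rw [← h0, circleAverage_fun_smul, h.circleAverage_pow_smul_resolvent hr]

theorem circleAverage_resolvent_cube (h : RittCondition a C) {r : ℝ} (hr : 1 < r) (n : ℕ) :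
    circleAverage (fun z => z ^ (n + 3) • (2 : ℂ) • resolvent a z ^ 3) (0 : ℂ) r =
      (((n : ℂ) + 2) * ((n : ℂ) + 1)) • a ^ n := by
  have hr0 : 0 < r := by linarith
  have hd : ∀ z : ℂ, ‖z‖ = r → HasDerivAt (fun z => z ^ (n + 2) • (resolvent a z * resolvent a z))
      (z ^ (n + 2) • (-resolvent a z ^ 2 * resolvent a z + resolvent a z * -resolvent a z ^ 2)
        + (((n + 2 : ℕ) : ℂ) * z ^ (n + 1)) • (resolvent a z * resolvent a z)) z := by
    intro z hz
    have hR := h.hasDerivAt_resolvent (z := z) (by linarith)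
    exact (hasDerivAt_pow (n + 2) z).smul (hR.mul hR)
  have h0 := circleAverage_smul_deriv_eq_zero hr0 hd
  have e : (fun z : ℂ => z • (z ^ (n + 2) •
      (-resolvent a z ^ 2 * resolvent a z + resolvent a z * -resolvent a z ^ 2)
        + (((n + 2 : ℕ) : ℂ) * z ^ (n + 1)) • (resolvent a z * resolvent a z))) =
      fun z => (((n : ℂ) + 2) * z ^ (n + 2)) • resolvent a z ^ 2
        - (2 * z ^ (n + 3)) • resolvent a z ^ 3 := by
    ext z
    rw [neg_mul, mul_neg, ← pow_succ, ← pow_succ', ← pow_two]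
    push_cast
    module
  rw [e, circleAverage_fun_sub (h.circleIntegrable_smul_resolvent_pow hr _ _ _)
    (h.circleIntegrable_smul_resolvent_pow hr _ _ _), sub_eq_zero] at h0
  simp only [mul_smul] at h0
  rw [mul_smul, ← h.circleAverage_resolvent_sq hr, ← circleAverage_fun_smul, h0]
  congr 1
  ext z
  rw [smul_comm]

/-- Represent (n+2)(n+1) aⁿ by the cube of the resolvent. Since (1 - a) R = 1 - (z - 1) R is bounded
by 1 + C, only R² is left to estimate; it is at most C² |z - 1|⁻², with mean at most C² N/2 on
radius 1 + 1/N. With N = n + 2 one factor N cancels. -/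
theorem norm_mul_pow_sub_pow_le [NormOneClass A] (h : RittCondition a C) (n : ℕ) :
    ((n : ℝ) + 1) * ‖(1 - a) * a ^ n‖ ≤ 6 * (1 + C) * C ^ 2 := by
  have hC := h.nonneg
  obtain ⟨N, hN⟩ : ∃ N : ℕ, N = n + 2 := ⟨_, rfl⟩
  have hN0 : 0 < N := by omega
  have hN' : (0 : ℝ) < N := by exact_mod_cast hN0
  obtain ⟨r, hr⟩ : ∃ r : ℝ, r = 1 + (N : ℝ)⁻¹ := ⟨_, rfl⟩
  have hr1 : 1 < r := by rw [hr]; have := inv_pos.2 hN'; linarith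
  have hr2 : r ≤ 2 := by
    have : (N : ℝ)⁻¹ ≤ 1 := inv_le_one_of_one_le₀ (by exact_mod_cast hN0)
    linarith
  have hrN : r ^ N ≤ 3 := hr ▸ one_add_inv_pow_le hN0 le_rfl
  have hr3 : (r ^ 2 - 1)⁻¹ ≤ (N : ℝ) / 2 := hr ▸ sq_one_add_inv_sub_one_inv_le hN0
  have hr0 : 0 < r := by linarith
  have hR := h.continuousOn_resolvent hr1
  have hp : ∀ m : ℕ, ContinuousOn (fun z : ℂ => z ^ m) (Metric.sphere 0 r) := fun m => by fun_prop
  have hi : CircleIntegrable (fun z => z ^ (n + 3) • (2 : ℂ) • resolvent a z ^ 3) 0 r := by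
    refine ContinuousOn.circleIntegrable hr0.le ?_
    exact (hp _).smul ((hR.pow 3).const_smul (2 : ℂ))
  have hL := (ContinuousLinearMap.mul ℝ A (1 - a)).circleAverage_comp_comm hi
  simp only [Function.comp_def, ContinuousLinearMap.mul_apply'] at hL
  rw [h.circleAverage_resolvent_cube hr1, mul_smul_comm] at hL
  have h1 : ‖(((n : ℂ) + 2) * ((n : ℂ) + 1)) • ((1 - a) * a ^ n)‖ =
      N * (((n : ℝ) + 1) * ‖(1 - a) * a ^ n‖) := by
    rw [norm_smul, norm_mul, hN]
    have e1 : ‖(n : ℂ) + 2‖ = (n : ℝ) + 2 := by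
      rw [show (n : ℂ) + 2 = ((n + 2 : ℕ) : ℂ) by push_cast; rfl, Complex.norm_natCast]
      push_cast; rfl
    have e2 : ‖(n : ℂ) + 1‖ = (n : ℝ) + 1 := by
      rw [show (n : ℂ) + 1 = ((n + 1 : ℕ) : ℂ) by push_cast; rfl, Complex.norm_natCast]
      push_cast; rfl
    rw [e1, e2]
    push_cast
    ring
  have h2 : ‖(((n : ℂ) + 2) * ((n : ℂ) + 1)) • ((1 - a) * a ^ n)‖ ≤
      (12 * (1 + C) * C ^ 2) * (r ^ 2 - 1)⁻¹ := by
    rw [← hL, ← circleAverage_norm_sub_one_inv_sq hr1, ← smul_eq_mul (12 * (1 + C) * C ^ 2),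
      ← circleAverage_fun_smul]
    refine (norm_circleAverage_le _ _ _).trans (circleAverage_mono ?_ ?_ ?_)
    · refine ContinuousOn.circleIntegrable hr0.le (ContinuousOn.norm ?_)
      exact ((hp _).smul ((hR.pow 3).const_smul (2 : ℂ))).const_mul (1 - a)
    · refine ContinuousOn.circleIntegrable hr0.le ?_
      exact continuousOn_const.mul ((continuousOn_sub_one_inv hr1).norm.pow 2)
    · intro z hz
      rw [abs_of_pos hr0, mem_sphere_zero_iff_norm] at hz
      have hz1 : 1 < ‖z‖ := by linarith
      have e : (1 - a) * z ^ (n + 3) • (2 : ℂ) • resolvent a z ^ 3 =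
          (z ^ (n + 3) * 2) • ((1 - (z - 1) • resolvent a z) * (resolvent a z * resolvent a z)) := by
        rw [mul_smul_comm, mul_smul_comm, ← h.one_sub_mul_resolvent hz1, mul_smul]
        congr 2
        noncomm_ring
      rw [e, norm_smul, smul_eq_mul, norm_mul, norm_pow, hz]
      have b1 : ‖1 - (z - 1) • resolvent a z‖ ≤ 1 + C := by
        refine (norm_sub_le _ _).trans ?_
        rw [norm_one, norm_smul]
        linarith [h.norm_le z hz1]
      have b2 := h.norm_resolvent_le hz1
      have b3 : r ^ (n + 3) * ‖(2 : ℂ)‖ ≤ 12 := by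
        rw [show n + 3 = N + 1 by omega, pow_succ]
        norm_num
        nlinarith [pow_pos hr0 N]
      calc r ^ (n + 3) * ‖(2 : ℂ)‖ *
            ‖(1 - (z - 1) • resolvent a z) * (resolvent a z * resolvent a z)‖
          ≤ 12 * ((1 + C) * ((C * ‖(z - 1)⁻¹‖) * (C * ‖(z - 1)⁻¹‖))) := by
            refine mul_le_mul b3 ?_ (norm_nonneg _) (by norm_num)
            refine (norm_mul_le _ _).trans (mul_le_mul b1 ?_ (norm_nonneg _) (by linarith))
            exact (norm_mul_le _ _).trans (mul_le_mul b2 b2 (norm_nonneg _) (by positivity))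
        _ = _ := by ring
  rw [h1] at h2
  have h3 : (12 * (1 + C) * C ^ 2) * (r ^ 2 - 1)⁻¹ ≤ (12 * (1 + C) * C ^ 2) * (N / 2) :=
    mul_le_mul_of_nonneg_left hr3 (by positivity)
  refine le_of_mul_le_mul_left (h2.trans (h3.trans (le_of_eq ?_))) hN'
  ring

end RittCondition

/-- Put b_i = a^(2^i) - 1, so that b_{i+1} = 2 b_i + b_i². The inequality x ≤ 1/8 + x² for x = ‖b_i‖
leaves a gap that steps of size 1/8 cannot jump, so ‖b_i‖ stays below 1/4. But then it grows by a
factor 7/4 each time, which is possible only if b_0 = 0. -/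
theorem eq_one_of_norm_dyadic_le {A : Type*} [NormedRing A] [NormedAlgebra ℂ A] {a : A}
    (h0 : ‖a - 1‖ ≤ 1 / 8) (h : ∀ i : ℕ, ‖a ^ 2 ^ i - a ^ 2 ^ (i + 1)‖ ≤ 1 / 8) : a = 1 := by
  have hsq : ∀ i : ℕ, a ^ 2 ^ (i + 1) = a ^ 2 ^ i * a ^ 2 ^ i := fun i => by
    rw [pow_succ, pow_mul, pow_two]
  have key : ∀ i : ℕ, ‖a ^ 2 ^ i - 1‖ ≤ 1 / 8 + ‖a ^ 2 ^ i - 1‖ ^ 2 := by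
    intro i
    have e : a ^ 2 ^ i - 1 = -(a ^ 2 ^ i - a ^ 2 ^ (i + 1)) - (a ^ 2 ^ i - 1) * (a ^ 2 ^ i - 1) := by
      rw [hsq]
      noncomm_ring
    calc ‖a ^ 2 ^ i - 1‖
        = ‖-(a ^ 2 ^ i - a ^ 2 ^ (i + 1)) - (a ^ 2 ^ i - 1) * (a ^ 2 ^ i - 1)‖ := by rw [← e]
      _ ≤ ‖a ^ 2 ^ i - a ^ 2 ^ (i + 1)‖ + ‖a ^ 2 ^ i - 1‖ * ‖a ^ 2 ^ i - 1‖ := by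
          refine (norm_sub_le _ _).trans ?_
          rw [norm_neg]
          gcongr
          exact norm_mul_le _ _
      _ ≤ _ := by rw [← pow_two]; gcongr; exact h i
  have small : ∀ i : ℕ, ‖a ^ 2 ^ i - 1‖ ≤ 1 / 4 := by
    intro i
    induction i with
    | zero => simpa using h0.trans (by norm_num)
    | succ i ih =>
      have h1 := key i
      have h2 := key (i + 1)
      have h3 : ‖a ^ 2 ^ (i + 1) - 1‖ ≤ ‖a ^ 2 ^ i - 1‖ + ‖a ^ 2 ^ i - a ^ 2 ^ (i + 1)‖ := by
        have := norm_sub_le (a ^ 2 ^ i - 1) (a ^ 2 ^ i - a ^ 2 ^ (i + 1))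
        rwa [sub_sub_sub_cancel_left] at this
      have h4 := h i
      have h5 : ‖a ^ 2 ^ i - 1‖ ≤ 1 / 6 := by nlinarith [norm_nonneg (a ^ 2 ^ i - 1)]
      nlinarith [norm_nonneg (a ^ 2 ^ (i + 1) - 1)]
  have grow : ∀ i : ℕ, (7 / 4 : ℝ) ^ i * ‖a - 1‖ ≤ ‖a ^ 2 ^ i - 1‖ := by
    intro i
    induction i with
    | zero => simp
    | succ i ih =>
      have e : (2 : ℂ) • (a ^ 2 ^ i - 1) =
          (a ^ 2 ^ (i + 1) - 1) - (a ^ 2 ^ i - 1) * (a ^ 2 ^ i - 1) := by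
        rw [hsq, two_smul]
        noncomm_ring
      have h1 : 2 * ‖a ^ 2 ^ i - 1‖ ≤
          ‖a ^ 2 ^ (i + 1) - 1‖ + ‖a ^ 2 ^ i - 1‖ * ‖a ^ 2 ^ i - 1‖ := by
        have := congrArg norm e
        rw [norm_smul, Complex.norm_ofNat] at this
        rw [this]
        refine (norm_sub_le _ _).trans ?_
        gcongr
        exact norm_mul_le _ _
      rw [pow_succ]
      nlinarith [small i, norm_nonneg (a ^ 2 ^ i - 1)]
  by_contra hne
  have hpos : 0 < ‖a - 1‖ := norm_pos_iff.2 (sub_ne_zero.2 hne)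
  obtain ⟨i, hi⟩ := pow_unbounded_of_one_lt (1 / ‖a - 1‖) (by norm_num : (1 : ℝ) < 7 / 4)
  rw [div_lt_iff₀ hpos] at hi
  linarith [grow i, small i]

end PowerDifferences

/-! ### Dyadic polynomial decomposition and bounds for its pieces. -/

noncomputable section DyadicDecomposition

open Real

/-- The mean `N⁻¹ (1 + X + ⋯ + X ^ (N - 1))`. -/
def geomMean (N : ℕ) : ℂ[X] := C ((N : ℂ)⁻¹) * ∑ j ∈ Finset.range N, X ^ j

/-- The polynomial `geomMean N * X ^ N`, corrected so that it equals `1` up to third order in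
`N (1 - X)`, modulo terms that do not depend on `N`. -/
def lowPass (N : ℕ) : ℂ[X] :=
  geomMean N * X ^ N * (1 + C (3 / 2) * (1 - X ^ N) + C (11 / 6) * (1 - X ^ N) ^ 2)

/-- The cofactor in `lowPass_sub_lowPass_two_mul`. -/
def bandFactor (N : ℕ) : ℂ[X] :=
  C (13 / 3) + C (17 / 3) * X ^ N + C (11 / 3) * (X ^ N) ^ 2 + C (11 / 12) * (X ^ N) ^ 3

theorem geomMean_mul_one_sub {N : ℕ} (hN : N ≠ 0) :
    C (N : ℂ) * geomMean N * (1 - X) = 1 - X ^ N := by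
  have hN' : (N : ℂ) ≠ 0 := by exact_mod_cast hN
  rw [geomMean, ← mul_assoc, ← C_mul, mul_inv_cancel₀ hN', C_1, one_mul, ← geom_sum_mul_neg]

theorem geomMean_two_mul (N : ℕ) :
    geomMean (2 * N) = geomMean N * (C (1 / 2) * (1 + X ^ N)) := by
  have h : ∑ j ∈ Finset.range (2 * N), (X : ℂ[X]) ^ j =
      (∑ j ∈ Finset.range N, X ^ j) * (1 + X ^ N) := by
    rw [two_mul, Finset.sum_range_add, mul_add, mul_one, Finset.sum_mul]
    congr 1
    exact Finset.sum_congr rfl fun j _ => by rw [pow_add, mul_comm]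
  rw [geomMean, geomMean, h]
  have : C (((2 * N : ℕ) : ℂ)⁻¹) = C ((N : ℂ)⁻¹) * C (1 / 2 : ℂ) := by
    rw [← C_mul]
    congr 1
    push_cast
    rw [mul_inv]
    ring
  rw [this]
  ring

/-- With w = X^N and v = 1 - w, the coefficients 1, 3/2, 11/6 are the Taylor coefficients of -log(1
- v)/(v(1 - v)). As `geomMean N` is v/(N(1 - X)), formally `lowPass N` is -log X/(1 - X) up to third
order in v, independently of N, so the difference vanishes to third order. One factor 1 - w goes to
the square function, the other two to the bounds on the cofactor. -/
theorem lowPass_sub_lowPass_two_mul (N : ℕ) :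
    lowPass N - lowPass (2 * N) =
      geomMean N * (1 - X ^ N) ^ 2 * bandFactor N * (X ^ N * (1 - X ^ N)) := by
  rw [lowPass, lowPass, geomMean_two_mul, bandFactor, show 2 * N = N * 2 from mul_comm _ _, pow_mul]
  generalize (X : ℂ[X]) ^ N = w
  generalize geomMean N = s
  refine Polynomial.funext fun z => ?_
  simp only [eval_mul, eval_add, eval_sub, eval_one, eval_C, eval_pow]
  ring

theorem one_sub_lowPass_one :
    1 - lowPass 1 = (1 - X) * (C (-1 / 2) - C (1 / 3) * (1 - X) + C (11 / 6) * (1 - X) ^ 2) := by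
  refine Polynomial.funext fun z => ?_
  simp [lowPass, geomMean]
  ring

theorem circleAverage_norm_geomMean_sq (N : ℕ) (r : ℝ) :
    circleAverage (fun z => ‖(geomMean N).eval z‖ ^ 2) 0 r =
      ((N : ℝ)⁻¹) ^ 2 * ∑ j ∈ Finset.range N, (r ^ 2) ^ j := by
  rw [← circleAverage_norm_geom_sum_sq, ← smul_eq_mul (((N : ℝ)⁻¹) ^ 2), ← circleAverage_fun_smul]
  congr 1
  ext z
  simp [geomMean, eval_finsetSum, mul_pow]

theorem norm_eval_geomMean_le (N : ℕ) {z : ℂ} (hz : ‖z‖ = 1) : ‖(geomMean N).eval z‖ ≤ 1 := by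
  rw [geomMean, eval_mul, eval_C, eval_finsetSum, norm_mul, norm_inv, Complex.norm_natCast]
  have h : ‖∑ j ∈ Finset.range N, eval z ((X : ℂ[X]) ^ j)‖ ≤ N := by
    refine (norm_sum_le _ _).trans ?_
    simp [hz]
  rcases N.eq_zero_or_pos with rfl | hN
  · simp
  · rw [inv_mul_le_iff₀ (by exact_mod_cast hN), mul_one]
    exact h

theorem norm_eval_bandFactor_le (N : ℕ) {z : ℂ} (hz : ‖z‖ = 1) :
    ‖(bandFactor N).eval z‖ ≤ 15 := by
  simp only [bandFactor, eval_add, eval_mul, eval_C, eval_pow, eval_X]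
  have hw : ‖z ^ N‖ = 1 := by rw [norm_pow, hz, one_pow]
  generalize z ^ N = w at hw
  refine (norm_add_le _ _).trans ((add_le_add_left ((norm_add_le _ _).trans
    (add_le_add_left (norm_add_le _ _) _)) _).trans ?_)
  simp only [norm_mul, norm_pow, hw]
  norm_num

theorem norm_one_sub_pow_le (N : ℕ) {z : ℂ} (hz : ‖z‖ = 1) : ‖1 - z ^ N‖ ≤ 2 := by
  refine (norm_sub_le _ _).trans ?_
  rw [norm_pow, hz, one_pow, norm_one]
  norm_num

/-- A polynomial of degree at most `n` bounded by `M` on the unit circle is bounded by `r ^ n M` on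
the circle of radius `r ≥ 1`. -/
theorem norm_eval_le_pow_mul {p : ℂ[X]} {n : ℕ} {M : ℝ} (hn : p.natDegree ≤ n)
    (hM : ∀ z : ℂ, ‖z‖ = 1 → ‖p.eval z‖ ≤ M) {z : ℂ} (hz : 1 ≤ ‖z‖) :
    ‖p.eval z‖ ≤ ‖z‖ ^ n * M := by
  have hrefl : ∀ w : ℂ, w ≠ 0 → eval w⁻¹ (reflect n p) * w ^ n = eval w p := by
    intro w hw
    let _ := invertibleOfNonzero hw
    simpa [eval₂_eq_eval_map] using eval₂_reflect_mul_pow (RingHom.id ℂ) w n p hn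
  have hz0 : z ≠ 0 := norm_pos_iff.1 (by linarith)
  -- Maximum principle for the reversed polynomial, bounded by M on the unit circle as p is.
  have hmax : ‖eval z⁻¹ (reflect n p)‖ ≤ M := by
    refine Complex.norm_le_of_forall_mem_frontier_norm_le (U := Metric.ball 0 1)
      Metric.isBounded_ball (f := fun w => eval w (reflect n p))
      (reflect n p).differentiable.diffContOnCl ?_ ?_
    · intro w hw
      rw [frontier_ball _ one_ne_zero, mem_sphere_zero_iff_norm] at hw
      have hw0 : w ≠ 0 := norm_pos_iff.1 (by linarith)
      have h1 := hrefl w⁻¹ (inv_ne_zero hw0)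
      rw [inv_inv] at h1
      have h2 := hM w⁻¹ (by rw [norm_inv, hw, inv_one])
      rwa [← h1, norm_mul, norm_pow, norm_inv, hw, inv_one, one_pow, mul_one] at h2
    · rw [closure_ball _ one_ne_zero, mem_closedBall_zero_iff, norm_inv]
      exact inv_le_one_of_one_le₀ hz
  rw [← hrefl z hz0, norm_mul, norm_pow, mul_comm]
  gcongr

namespace RittCondition

variable {A : Type*} [NormedRing A] [NormedAlgebra ℂ A] [CompleteSpace A] {a : A} {C : ℝ}

/-- N |`geomMean N`|² is the Fejér kernel: by Parseval its mean over the unit circle is 1. -/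
theorem norm_aeval_one_sub_mul_le_of_le_geomMean (h : RittCondition a C) {N : ℕ} (hN : 0 < N)
    {D : ℝ} {g : ℂ[X]}
    (hg : ∀ z : ℂ, ‖z‖ = 1 → ‖g.eval z‖ ≤ D * N * ‖(geomMean N).eval z‖ ^ 2) :
    ‖aeval a ((1 - X) * g)‖ ≤ C * D := by
  have hN' : (0 : ℝ) < N := by exact_mod_cast hN
  refine (h.norm_aeval_one_sub_mul_le g).trans (mul_le_mul_of_nonneg_left ?_ h.nonneg)
  have e : D = circleAverage (fun z => (D * N) • ‖(geomMean N).eval z‖ ^ 2) 0 1 := by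
    rw [circleAverage_fun_smul, circleAverage_norm_geomMean_sq]
    simp
    field_simp
  rw [e]
  refine circleAverage_mono ?_ ?_ ?_
  · exact (g.continuous.norm.continuousOn).circleIntegrable zero_le_one
  · refine ContinuousOn.circleIntegrable zero_le_one (Continuous.continuousOn ?_)
    exact ((geomMean N).continuous.norm.pow 2).const_smul (D * N)
  · intro z hz
    rw [abs_one, mem_sphere_zero_iff_norm] at hz
    exact hg z hz

theorem norm_aeval_band_mul_le (h : RittCondition a C) {N : ℕ} (hN : 0 < N) {p : ℂ[X]} {M : ℝ}
    (hM : ∀ z : ℂ, ‖z‖ = 1 → ‖p.eval z‖ ≤ M) :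
    ‖aeval a (geomMean N * (1 - X ^ N) ^ 2 * bandFactor N * p)‖ ≤ C * (30 * M) := by
  have e : geomMean N * (1 - X ^ N) ^ 2 * bandFactor N * p =
      (1 - X) * (Polynomial.C (N : ℂ) * geomMean N ^ 2 * (1 - X ^ N) * bandFactor N * p) := by
    rw [pow_two (1 - X ^ N)]
    nth_rewrite 1 [← geomMean_mul_one_sub hN.ne']
    ring
  rw [e]
  refine h.norm_aeval_one_sub_mul_le_of_le_geomMean hN fun z hz => ?_
  simp only [eval_mul, eval_C, eval_pow, eval_sub, eval_one, eval_X, norm_mul, norm_pow,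
    Complex.norm_natCast]
  have h1 := norm_one_sub_pow_le N hz
  have h2 := norm_eval_bandFactor_le N hz
  have h3 := hM z hz
  calc (N : ℝ) * ‖(geomMean N).eval z‖ ^ 2 * ‖1 - z ^ N‖ * ‖(bandFactor N).eval z‖ * ‖p.eval z‖
      ≤ (N : ℝ) * ‖(geomMean N).eval z‖ ^ 2 * 2 * 15 * M := by gcongr
    _ = _ := by ring

theorem norm_aeval_band_X_pow_mul_le [NormOneClass A] (h : RittCondition a C) {N : ℕ} (hN : 0 < N)
    {q : ℂ[X]} {M : ℝ} (hM : ∀ z : ℂ, ‖z‖ = 1 → ‖q.eval z‖ ≤ M) (m : ℕ) :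
    ‖aeval a (geomMean N * (1 - X ^ N) ^ 2 * bandFactor N * (X ^ m * q))‖ ≤
      C * (6 * (1 + C) * C ^ 2) * (15 * M) * (N / ((m : ℝ) + 1)) := by
  -- Both factors 1 - X^N are traded for N (1 - X) `geomMean N`: one 1 - X pairs with X^m for decay,
  -- the other with the Fejér kernel.
  have e : geomMean N * (1 - X ^ N) ^ 2 * bandFactor N * (X ^ m * q) =
      ((1 - X) * X ^ m) *
        ((1 - X) * (Polynomial.C (N : ℂ) ^ 2 * geomMean N ^ 3 * bandFactor N * q)) := by
    rw [← geomMean_mul_one_sub hN.ne']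
    ring
  have hm : (0 : ℝ) < (m : ℝ) + 1 := by positivity
  have h1 : ‖(1 - a) * a ^ m‖ ≤ 6 * (1 + C) * C ^ 2 / ((m : ℝ) + 1) := by
    rw [le_div_iff₀ hm, mul_comm]
    exact h.norm_mul_pow_sub_pow_le m
  have h2 : ‖aeval a ((1 - X) * (Polynomial.C (N : ℂ) ^ 2 * geomMean N ^ 3 * bandFactor N * q))‖ ≤
      C * (N * (15 * M)) := by
    refine h.norm_aeval_one_sub_mul_le_of_le_geomMean hN fun z hz => ?_
    simp only [eval_mul, eval_C, eval_pow, norm_mul, norm_pow, Complex.norm_natCast]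
    have b1 := norm_eval_geomMean_le N hz
    have b2 := norm_eval_bandFactor_le N hz
    have b3 := hM z hz
    calc (N : ℝ) ^ 2 * ‖(geomMean N).eval z‖ ^ 3 * ‖(bandFactor N).eval z‖ * ‖q.eval z‖
        = (N : ℝ) ^ 2 * (‖(geomMean N).eval z‖ ^ 2 * ‖(geomMean N).eval z‖) *
            ‖(bandFactor N).eval z‖ * ‖q.eval z‖ := by ring
      _ ≤ (N : ℝ) ^ 2 * (‖(geomMean N).eval z‖ ^ 2 * 1) * 15 * M := by gcongr
      _ = _ := by ring
  rw [e, map_mul]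
  have e3 : aeval a ((1 - X) * X ^ m : ℂ[X]) = (1 - a) * a ^ m := by simp
  rw [e3]
  refine (norm_mul_le _ _).trans ((mul_le_mul h1 h2 (norm_nonneg _)
    ((norm_nonneg _).trans h1)).trans (le_of_eq ?_))
  field_simp

theorem norm_aeval_one_sub_lowPass_one_mul_le (h : RittCondition a C) {p : ℂ[X]} {M : ℝ}
    (hM : ∀ z : ℂ, ‖z‖ = 1 → ‖p.eval z‖ ≤ M) :
    ‖aeval a ((1 - lowPass 1) * p)‖ ≤ C * (9 * M) := by
  rw [one_sub_lowPass_one, mul_assoc]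
  refine (h.norm_aeval_one_sub_mul_le _).trans (mul_le_mul_of_nonneg_left ?_ h.nonneg)
  refine circleAverage_mono_on_of_le_circle
    (Polynomial.continuous _).norm.continuousOn.circleIntegrable' fun z hz => ?_
  rw [abs_one, mem_sphere_zero_iff_norm] at hz
  rw [eval_mul, norm_mul]
  refine mul_le_mul ?_ (hM z hz) (norm_nonneg _) (by norm_num)
  have hv := norm_one_sub_pow_le 1 hz
  rw [pow_one] at hv
  simp only [eval_mul, eval_C, eval_pow, eval_sub, eval_add, eval_one, eval_X]
  refine (norm_add_le _ _).trans ((add_le_add_left (norm_sub_le _ _) _).trans ?_)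
  simp only [norm_mul, norm_pow]
  norm_num
  nlinarith [norm_nonneg (1 - z)]

/-- No factor 1 - X is available, so |z - 1|⁻¹ is kept and paired with `geomMean N` by a weighted
arithmetic–geometric inequality on radius 1 + 1/N; there both weighted squares have bounded mean,
and degrees up to N cost at most a factor 3. -/
theorem norm_aeval_lowPass_mul_le (h : RittCondition a C) {N : ℕ} (hN : 0 < N) {p : ℂ[X]} {M : ℝ}
    (hn : p.natDegree ≤ N) (hM : ∀ z : ℂ, ‖z‖ = 1 → ‖p.eval z‖ ≤ M) :
    ‖aeval a (lowPass N * p)‖ ≤ C * (3200 * M) := by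
  have hN' : (0 : ℝ) < N := by exact_mod_cast hN
  have hM0 : 0 ≤ M := (norm_nonneg _).trans (hM 1 norm_one)
  obtain ⟨r, hr⟩ : ∃ r : ℝ, r = 1 + (N : ℝ)⁻¹ := ⟨_, rfl⟩
  have hr1 : 1 < r := by rw [hr]; have := inv_pos.2 hN'; linarith
  have hr2 : r ≤ 2 := by
    have : (N : ℝ)⁻¹ ≤ 1 := inv_le_one_of_one_le₀ (by exact_mod_cast hN)
    linarith
  have hrN : ∀ j ≤ N, r ^ j ≤ 3 := fun j hj => hr ▸ one_add_inv_pow_le hN hj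
  have hr3 : (r ^ 2 - 1)⁻¹ ≤ (N : ℝ) / 2 := hr ▸ sq_one_add_inv_sub_one_inv_le hN
  have hr0 : 0 < r := by linarith
  refine (h.norm_aeval_le hr1 _).trans ?_
  have hS : Continuous fun z => (N : ℝ) • ‖(geomMean N).eval z‖ ^ 2 :=
    ((geomMean N).continuous.norm.pow 2).const_smul (N : ℝ)
  have i1 : CircleIntegrable (fun z : ℂ => (N : ℝ) • ‖(geomMean N).eval z‖ ^ 2) 0 r :=
    hS.continuousOn.circleIntegrable hr0.le
  have i2 : CircleIntegrable (fun z : ℂ => (N : ℝ)⁻¹ • ‖(z - 1)⁻¹‖ ^ 2) 0 r := by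
    refine ContinuousOn.circleIntegrable hr0.le ?_
    exact continuousOn_const.mul ((continuousOn_sub_one_inv hr1).norm.pow 2)
  have bound : circleAverage (fun z => ‖(lowPass N * p).eval z‖ * ‖(z - 1)⁻¹‖) 0 r ≤
      333 * M / 2 * (9 + 1 / 2) := by
    have avg : circleAverage (fun z => (333 * M / 2) • ((N : ℝ) • ‖(geomMean N).eval z‖ ^ 2 +
        (N : ℝ)⁻¹ • ‖(z - 1)⁻¹‖ ^ 2)) 0 r ≤ 333 * M / 2 * (9 + 1 / 2) := by
      rw [circleAverage_fun_smul, circleAverage_fun_add i1 i2, circleAverage_fun_smul,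
        circleAverage_fun_smul, circleAverage_norm_geomMean_sq,
        circleAverage_norm_sub_one_inv_sq hr1]
      simp only [smul_eq_mul]
      have s1 : ∑ j ∈ Finset.range N, (r ^ 2) ^ j ≤ N * 9 := by
        calc ∑ j ∈ Finset.range N, (r ^ 2) ^ j ≤ ∑ j ∈ Finset.range N, (9 : ℝ) := by
              refine Finset.sum_le_sum fun j hj => ?_
              have := hrN j (Finset.mem_range.1 hj).le
              rw [← pow_mul, mul_comm, pow_mul]
              nlinarith [pow_pos hr0 j]
          _ = N * 9 := by simp
      gcongr
      · calc (N : ℝ) * ((N : ℝ)⁻¹ ^ 2 * ∑ j ∈ Finset.range N, (r ^ 2) ^ j)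
            ≤ (N : ℝ) * ((N : ℝ)⁻¹ ^ 2 * (N * 9)) := by gcongr
          _ = 9 := by field_simp
      · calc (N : ℝ)⁻¹ * (r ^ 2 - 1)⁻¹ ≤ (N : ℝ)⁻¹ * (N / 2) := by gcongr
          _ = 1 / 2 := by field_simp
    refine (circleAverage_mono ?_ ?_ ?_).trans avg
    · refine ContinuousOn.circleIntegrable hr0.le ?_
      exact (Polynomial.continuous _).norm.continuousOn.mul (continuousOn_sub_one_inv hr1).norm
    · exact (i1.add i2).const_smul
    · intro z hz
      rw [abs_of_pos hr0, mem_sphere_zero_iff_norm] at hz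
      have b1 : ‖p.eval z‖ ≤ 3 * M :=
        (norm_eval_le_pow_mul hn hM (by linarith)).trans
          (mul_le_mul_of_nonneg_right (hz ▸ hrN N le_rfl) hM0)
      have b2 : ‖z ^ N‖ ≤ 3 := by rw [norm_pow, hz]; exact hrN N le_rfl
      have b3 : ‖1 - z ^ N‖ ≤ 4 := by
        refine (norm_sub_le _ _).trans ?_
        rw [norm_one]
        linarith
      have b4 : ‖1 + 3 / 2 * (1 - z ^ N) + 11 / 6 * (1 - z ^ N) ^ 2‖ ≤ 37 := by
        refine (norm_add_le _ _).trans ((add_le_add_left (norm_add_le _ _) _).trans ?_)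
        simp only [norm_mul, norm_pow, norm_one]
        norm_num
        nlinarith [norm_nonneg (1 - z ^ N)]
      simp only [lowPass, eval_mul, eval_add, eval_sub, eval_one, eval_C, eval_pow, eval_X,
        norm_mul, smul_eq_mul]
      generalize hs : ‖(geomMean N).eval z‖ = s
      generalize ht : ‖(z - 1)⁻¹‖ = t
      have hs0 : 0 ≤ s := hs ▸ norm_nonneg _
      have ht0 : 0 ≤ t := ht ▸ norm_nonneg _
      have amgm : s * t ≤ (N * s ^ 2 + (N : ℝ)⁻¹ * t ^ 2) / 2 := by
        have := mul_nonneg (inv_pos.2 hN').le (sq_nonneg (N * s - t))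
        have e : (N : ℝ)⁻¹ * (N * s - t) ^ 2 = N * s ^ 2 + (N : ℝ)⁻¹ * t ^ 2 - 2 * (s * t) := by
          field_simp
          ring
        linarith
      calc s * ‖z ^ N‖ * ‖1 + 3 / 2 * (1 - z ^ N) + 11 / 6 * (1 - z ^ N) ^ 2‖ * ‖p.eval z‖ * t
          ≤ s * 3 * 37 * (3 * M) * t := by gcongr
        _ = 333 * M * (s * t) := by ring
        _ ≤ 333 * M * ((N * s ^ 2 + (N : ℝ)⁻¹ * t ^ 2) / 2) := by gcongr
        _ = _ := by ring
  have hC := h.nonneg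
  have h0 : 0 ≤ circleAverage (fun z => ‖(lowPass N * p).eval z‖ * ‖(z - 1)⁻¹‖) 0 r :=
    circleAverage_nonneg_of_nonneg fun z _ => by positivity
  calc r * C * circleAverage (fun z => ‖(lowPass N * p).eval z‖ * ‖(z - 1)⁻¹‖) 0 r
      ≤ 2 * C * (333 * M / 2 * (9 + 1 / 2)) := by gcongr
    _ ≤ C * (3200 * M) := by nlinarith [mul_nonneg hC hM0]

end RittCondition

theorem eq_band_decomposition (p : ℂ[X]) (I : ℕ) :
    p = (1 - lowPass 1) * p +
      ∑ i ∈ Finset.range I, (geomMean (2 ^ i) * (1 - X ^ 2 ^ i) ^ 2 * bandFactor (2 ^ i) * p) *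
        (X ^ 2 ^ i * (1 - X ^ 2 ^ i)) + lowPass (2 ^ I) * p := by
  have h := Finset.sum_range_sub' (fun i => lowPass (2 ^ i)) I
  have e : ∑ i ∈ Finset.range I, (geomMean (2 ^ i) * (1 - X ^ 2 ^ i) ^ 2 * bandFactor (2 ^ i) * p) *
        (X ^ 2 ^ i * (1 - X ^ 2 ^ i)) =
      (∑ i ∈ Finset.range I, (lowPass (2 ^ i) - lowPass (2 ^ (i + 1)))) * p := by
    rw [Finset.sum_mul]
    refine Finset.sum_congr rfl fun i _ => ?_
    rw [pow_succ' 2 i, lowPass_sub_lowPass_two_mul]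
    ring
  rw [e, h, pow_zero]
  ring

theorem aeval_eq_band_decomposition {A : Type*} [Ring A] [Algebra ℂ A] (a : A) (p : ℂ[X]) (I : ℕ) :
    aeval a p = aeval a ((1 - lowPass 1) * p) +
      ∑ i ∈ Finset.range I, aeval a (geomMean (2 ^ i) * (1 - X ^ 2 ^ i) ^ 2 * bandFactor (2 ^ i) * p) *
        (a ^ 2 ^ i * (1 - a ^ 2 ^ i)) + aeval a (lowPass (2 ^ I) * p) := by
  have h := congrArg (aeval a) (eq_band_decomposition p I)
  rw [map_add, map_add, map_sum] at h
  rw [h]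
  have e : ∀ N : ℕ, aeval a (X ^ N * (1 - X ^ N) : ℂ[X]) = a ^ N * (1 - a ^ N) := fun N => by simp
  have e2 : ∀ i : ℕ, aeval a (geomMean (2 ^ i) * (1 - X ^ 2 ^ i) ^ 2 * bandFactor (2 ^ i) * p *
      (X ^ 2 ^ i * (1 - X ^ 2 ^ i))) =
      aeval a (geomMean (2 ^ i) * (1 - X ^ 2 ^ i) ^ 2 * bandFactor (2 ^ i) * p) *
        (a ^ 2 ^ i * (1 - a ^ 2 ^ i)) := fun i => by rw [map_mul, e]
  rw [Finset.sum_congr rfl fun i _ => e2 i]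

end DyadicDecomposition

/-! ### Dyadic consequences of square function estimates. -/

section SquareFunction

variable {E : Type*} [NormedAddCommGroup E] [NormedSpace ℂ E] {T : E →L[ℂ] E} {K : ℝ}

theorem pow_sub_pow_two_mul_eq_sum {A : Type*} [Ring A] (a : A) (N : ℕ) :
    a ^ N - a ^ (2 * N) = ∑ k ∈ Finset.Ico N (2 * N), (a ^ k - a ^ (k + 1)) := by
  rw [Finset.sum_Ico_eq_sum_range, two_mul, Nat.add_sub_cancel]
  have := Finset.sum_range_sub' (fun k => a ^ (N + k)) N
  simpa [add_assoc] using this.symm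

theorem sum_range_sum_Ico_two_pow (f : ℕ → ℝ) (I : ℕ) :
    ∑ i ∈ Finset.range I, ∑ k ∈ Finset.Ico (2 ^ i) (2 * 2 ^ i), f k =
      ∑ k ∈ Finset.Ico 1 (2 ^ I), f k := by
  induction I with
  | zero => simp
  | succ I ih =>
    rw [Finset.sum_range_succ, ih, ← pow_succ']
    exact Finset.sum_Ico_consecutive f Nat.one_le_two_pow (Nat.pow_le_pow_right two_pos I.le_succ)

/-- T^N - T^(2N) telescopes into N differences; Cauchy–Schwarz costs a factor N, which the weights k
+ 1 > N on the block N ≤ k < 2N pay for. The dyadic blocks are disjoint. -/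
theorem SquareFunctionEstimate.sum_norm_dyadic_sq_le (h : SquareFunctionEstimate T K) (x : E)
    (I : ℕ) :
    ∑ i ∈ Finset.range I, ‖(T ^ 2 ^ i * (1 - T ^ 2 ^ i) : E →L[ℂ] E) x‖ ^ 2 ≤ K ^ 2 * ‖x‖ ^ 2 := by
  obtain ⟨hs, hle⟩ := h.2 x
  have block : ∀ N : ℕ, ‖(T ^ N * (1 - T ^ N) : E →L[ℂ] E) x‖ ^ 2 ≤
      ∑ k ∈ Finset.Ico N (2 * N), ((k : ℝ) + 1) * ‖(T ^ (k + 1)) x - (T ^ k) x‖ ^ 2 := by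
    intro N
    have e : (T ^ N * (1 - T ^ N) : E →L[ℂ] E) x =
        ∑ k ∈ Finset.Ico N (2 * N), ((T ^ k) x - (T ^ (k + 1)) x) := by
      rw [mul_sub, mul_one, ← pow_add, ← two_mul, pow_sub_pow_two_mul_eq_sum]
      simp
    calc ‖(T ^ N * (1 - T ^ N) : E →L[ℂ] E) x‖ ^ 2
        ≤ (∑ k ∈ Finset.Ico N (2 * N), ‖(T ^ k) x - (T ^ (k + 1)) x‖) ^ 2 := by
          rw [e]
          gcongr
          exact norm_sum_le _ _
      _ ≤ (Finset.Ico N (2 * N)).card *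
            ∑ k ∈ Finset.Ico N (2 * N), ‖(T ^ k) x - (T ^ (k + 1)) x‖ ^ 2 :=
          sq_sum_le_card_mul_sum_sq
      _ ≤ _ := by
          rw [Nat.card_Ico, two_mul, Nat.add_sub_cancel, Finset.mul_sum]
          refine Finset.sum_le_sum fun k hk => ?_
          have : (N : ℝ) ≤ k := by exact_mod_cast (Finset.mem_Ico.1 hk).1
          rw [norm_sub_rev]
          gcongr
          linarith
  calc ∑ i ∈ Finset.range I, ‖(T ^ 2 ^ i * (1 - T ^ 2 ^ i) : E →L[ℂ] E) x‖ ^ 2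
      ≤ _ := Finset.sum_le_sum fun i _ => block (2 ^ i)
    _ = _ := sum_range_sum_Ico_two_pow _ I
    _ ≤ _ := hs.sum_le_tsum _ fun k _ => by positivity
    _ ≤ _ := hle

theorem SquareFunctionEstimate.one_div_eight_le (h : SquareFunctionEstimate T K) (hT : T ≠ 1) :
    1 / 8 ≤ K := by
  by_contra! hK
  have hK0 := h.1
  refine hT (eq_one_of_norm_dyadic_le ?_ fun i => ?_)
  · refine ContinuousLinearMap.opNorm_le_bound _ (by norm_num) fun x => ?_
    obtain ⟨hs, hle⟩ := h.2 x
    have h1 := (hs.le_tsum 0 fun k _ => by positivity).trans hle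
    norm_num at h1
    rw [← mul_pow] at h1
    have h2 := le_of_sq_le_sq h1 (by positivity)
    refine h2.trans ?_
    gcongr
  · refine ContinuousLinearMap.opNorm_le_bound _ (by norm_num) fun x => ?_
    have h1 := (Finset.single_le_sum (fun j _ => sq_nonneg _) (Finset.self_mem_range_succ i)).trans
      (h.sum_norm_dyadic_sq_le x (i + 1))
    rw [← mul_pow] at h1
    have h2 := le_of_sq_le_sq h1 (by positivity)
    rw [mul_sub, mul_one, ← pow_add, ← two_mul, ← pow_succ'] at h2
    refine h2.trans ?_
    gcongr

end SquareFunction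

/-! ### Logarithmic sums over dyadic scales. -/

section Logarithm

/-- At t = 2^i/μ the right side is an increment of 3 log(1 + 2^i/μ), so the dyadic sum telescopes.
-/
theorem sq_min_one_le_log_sub_log {t : ℝ} (ht : 0 < t) :
    (min 1 t) ^ 2 ≤ 3 * (Real.log (1 + 2 * t) - Real.log (1 + t)) := by
  have h1 : t / (1 + 2 * t) ≤ Real.log (1 + 2 * t) - Real.log (1 + t) := by
    rw [← Real.log_div (by positivity) (by positivity)]
    refine le_trans (le_of_eq ?_) (Real.one_sub_inv_le_log_of_pos (by positivity))
    field_simp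
    ring
  have h2 : min 1 t ≤ 3 * (t / (1 + 2 * t)) := by
    rw [← mul_div_assoc, le_div_iff₀ (by positivity)]
    rcases le_total t 1 with h | h
    · rw [min_eq_right h]
      nlinarith
    · rw [min_eq_left h]
      linarith
  have h3 : 0 ≤ min 1 t := le_min zero_le_one ht.le
  nlinarith [min_le_left 1 t]

theorem sum_sq_min_one_two_pow_div_le {μ : ℝ} (hμ : 0 < μ) (I : ℕ) :
    ∑ i ∈ Finset.range I, (min 1 (2 ^ i / μ)) ^ 2 ≤ 3 * Real.log (1 + 2 ^ I / μ) := by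
  have h : ∀ i : ℕ, (min 1 ((2 : ℝ) ^ i / μ)) ^ 2 ≤
      3 * (Real.log (1 + 2 ^ (i + 1) / μ) - Real.log (1 + 2 ^ i / μ)) := by
    intro i
    have := sq_min_one_le_log_sub_log (t := 2 ^ i / μ) (by positivity)
    rwa [← mul_div_assoc, ← pow_succ'] at this
  refine (Finset.sum_le_sum fun i _ => h i).trans ?_
  rw [← Finset.mul_sum, Finset.sum_range_sub fun i => Real.log (1 + 2 ^ i / μ)]
  have : 0 ≤ Real.log (1 + 2 ^ 0 / μ) := Real.log_nonneg (by simp; positivity)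
  linarith

theorem log_add_two_div_add_one_nonneg {m n : ℕ} (hmn : m ≤ n) :
    0 ≤ Real.log (((n : ℝ) + 2) / ((m : ℝ) + 1)) := by
  have : (m : ℝ) ≤ n := by exact_mod_cast hmn
  refine Real.log_nonneg ?_
  rw [one_le_div (by positivity)]
  linarith

end Logarithm

/-! ### Assembling the pieces. -/

section FunctionalCalculus

variable {E : Type*} [NormedAddCommGroup E] [NormedSpace ℂ E] [CompleteSpace E] [Nontrivial E]
  {T : E →L[ℂ] E} {C K : ℝ}

theorem RittCondition.norm_aeval_le_of_squareFunctionEstimate (h : RittCondition T C)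
    (hK : SquareFunctionEstimate T K) {m n : ℕ} (hmn : m ≤ n) {q : ℂ[X]} {M : ℝ}
    (hn : (X ^ m * q).natDegree ≤ n) (hM : ∀ z : ℂ, ‖z‖ = 1 → ‖q.eval z‖ ≤ M) :
    ‖aeval T (X ^ m * q)‖ ≤ C * (3209 * M) +
      (30 * C + 90 * (1 + C) * C ^ 3) * M * K *
        Real.sqrt (6 * (1 + Real.log (((n : ℝ) + 2) / ((m : ℝ) + 1)))) := by
  have hC := h.nonneg
  have hM0 : 0 ≤ M := (norm_nonneg _).trans (hM 1 norm_one)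
  have hL := log_add_two_div_add_one_nonneg hmn
  have hμ : (0 : ℝ) < (m : ℝ) + 1 := by positivity
  obtain ⟨p, hp⟩ : ∃ p : ℂ[X], p = X ^ m * q := ⟨_, rfl⟩
  have hMp : ∀ z : ℂ, ‖z‖ = 1 → ‖p.eval z‖ ≤ M := by
    intro z hz
    rw [hp, eval_mul, eval_pow, eval_X, norm_mul, norm_pow, hz, one_pow, one_mul]
    exact hM z hz
  rw [← hp] at hn ⊢
  obtain ⟨I, hI⟩ : ∃ I : ℕ, I = Nat.clog 2 (n + 1) := ⟨_, rfl⟩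
  have hI1 : n + 1 ≤ 2 ^ I := hI ▸ Nat.le_pow_clog one_lt_two _
  -- The case n = 0 is separate because `Nat.clog 2 1 = 0` has no predecessor.
  have hI2 : 2 ^ I ≤ 2 * (n + 1) := by
    rcases Nat.eq_zero_or_pos n with rfl | hn0
    · simp [hI]
    · have := Nat.pow_pred_clog_lt_self one_lt_two (x := n + 1) (by omega)
      rw [← hI] at this
      have hIpos : 0 < I := hI ▸ Nat.clog_pos one_lt_two (by omega)
      obtain ⟨J, rfl⟩ : ∃ J, I = J + 1 := ⟨I - 1, by omega⟩
      rw [Nat.pred_eq_sub_one, Nat.add_sub_cancel] at this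
      rw [pow_succ]
      omega
  set B : ℝ := 30 * C + 90 * (1 + C) * C ^ 3 with hB
  have hB0 : 0 ≤ B := by positivity
  set Y : ℕ → E →L[ℂ] E := fun i =>
    aeval T (geomMean (2 ^ i) * (1 - X ^ 2 ^ i) ^ 2 * bandFactor (2 ^ i) * p) with hY
  have hYb : ∀ i, ‖Y i‖ ≤ B * M * min 1 (2 ^ i / ((m : ℝ) + 1)) := by
    intro i
    have h1 := h.norm_aeval_band_mul_le (N := 2 ^ i) (by positivity) hMp
    have h2 := h.norm_aeval_band_X_pow_mul_le (N := 2 ^ i) (by positivity) hM m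
    rw [← hp] at h2
    push_cast at h2
    have h3 : 0 ≤ 90 * (1 + C) * C ^ 3 * M := by positivity
    rcases min_choice 1 ((2 : ℝ) ^ i / ((m : ℝ) + 1)) with hmin | hmin
    · rw [hmin]
      refine h1.trans ?_
      rw [hB]
      nlinarith
    · rw [hmin]
      refine h2.trans ?_
      rw [hB]
      have h4 : 0 ≤ 30 * C * M * ((2 : ℝ) ^ i / ((m : ℝ) + 1)) := by positivity
      nlinarith
  have hsum : ∑ i ∈ Finset.range I, ‖Y i‖ ^ 2 ≤
      (B * M) ^ 2 * (6 * (1 + Real.log (((n : ℝ) + 2) / ((m : ℝ) + 1)))) := by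
    calc ∑ i ∈ Finset.range I, ‖Y i‖ ^ 2
        ≤ ∑ i ∈ Finset.range I, (B * M) ^ 2 * (min 1 (2 ^ i / ((m : ℝ) + 1))) ^ 2 := by
          refine Finset.sum_le_sum fun i _ => ?_
          rw [← mul_pow]
          gcongr
          exact hYb i
      _ ≤ (B * M) ^ 2 * (3 * Real.log (1 + 2 ^ I / ((m : ℝ) + 1))) := by
          rw [← Finset.mul_sum]
          gcongr
          exact sum_sq_min_one_two_pow_div_le hμ I
      _ ≤ _ := by
          refine mul_le_mul_of_nonneg_left ?_ (by positivity)
          have hI3 : (2 : ℝ) ^ I ≤ 2 * ((n : ℝ) + 1) := by exact_mod_cast hI2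
          have hmn' : (m : ℝ) ≤ n := by exact_mod_cast hmn
          have h1 : 1 + 2 ^ I / ((m : ℝ) + 1) ≤ 3 * (((n : ℝ) + 2) / ((m : ℝ) + 1)) := by
            rw [← mul_div_assoc, ← sub_nonneg]
            have : 3 * ((n : ℝ) + 2) / ((m : ℝ) + 1) - (1 + 2 ^ I / ((m : ℝ) + 1)) =
                (3 * ((n : ℝ) + 2) - ((m : ℝ) + 1) - 2 ^ I) / ((m : ℝ) + 1) := by
              field_simp
              ring
            rw [this]
            exact div_nonneg (by linarith) hμ.le
          have h2 := Real.log_le_log (by positivity) h1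
          rw [Real.log_mul (by norm_num) (by positivity)] at h2
          have h3 := Real.log_le_sub_one_of_pos (show (0 : ℝ) < 3 by norm_num)
          linarith
  refine ContinuousLinearMap.opNorm_le_bound _ (by have := hK.1; positivity) fun x => ?_
  have hdec : aeval T p = aeval T ((1 - lowPass 1) * p) +
      ∑ i ∈ Finset.range I, Y i * (T ^ 2 ^ i * (1 - T ^ 2 ^ i)) + aeval T (lowPass (2 ^ I) * p) :=
    aeval_eq_band_decomposition T p I
  have b1 := h.norm_aeval_one_sub_lowPass_one_mul_le hMp
  have b2 := h.norm_aeval_lowPass_mul_le (N := 2 ^ I) (by positivity) (by omega) hMp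
  have b3 : ∑ i ∈ Finset.range I, ‖Y i‖ * ‖(T ^ 2 ^ i * (1 - T ^ 2 ^ i) : E →L[ℂ] E) x‖ ≤
      B * M * K * Real.sqrt (6 * (1 + Real.log (((n : ℝ) + 2) / ((m : ℝ) + 1)))) * ‖x‖ := by
    refine (Real.sum_mul_le_sqrt_mul_sqrt _ _ _).trans ?_
    have hK0 := hK.1
    calc _ ≤ Real.sqrt ((B * M) ^ 2 * (6 * (1 + Real.log (((n : ℝ) + 2) / ((m : ℝ) + 1))))) *
          Real.sqrt (K ^ 2 * ‖x‖ ^ 2) :=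
          mul_le_mul (Real.sqrt_le_sqrt hsum) (Real.sqrt_le_sqrt (hK.sum_norm_dyadic_sq_le x I))
            (Real.sqrt_nonneg _) (Real.sqrt_nonneg _)
      _ = _ := by
          rw [Real.sqrt_mul (sq_nonneg _), Real.sqrt_sq (by positivity), ← mul_pow,
            Real.sqrt_sq (by positivity)]
          ring
  have e : aeval T p x = aeval T ((1 - lowPass 1) * p) x +
      ∑ i ∈ Finset.range I, Y i ((T ^ 2 ^ i * (1 - T ^ 2 ^ i) : E →L[ℂ] E) x) +
        aeval T (lowPass (2 ^ I) * p) x := by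
    rw [hdec]
    simp
  calc ‖aeval T p x‖ ≤ ‖aeval T ((1 - lowPass 1) * p) x‖ +
      ∑ i ∈ Finset.range I, ‖Y i ((T ^ 2 ^ i * (1 - T ^ 2 ^ i) : E →L[ℂ] E) x)‖ +
        ‖aeval T (lowPass (2 ^ I) * p) x‖ := by
        rw [e]
        refine (norm_add₃_le).trans ?_
        gcongr
        exact norm_sum_le _ _
    _ ≤ C * (9 * M) * ‖x‖ +
      B * M * K * Real.sqrt (6 * (1 + Real.log (((n : ℝ) + 2) / ((m : ℝ) + 1)))) * ‖x‖ +
        C * (3200 * M) * ‖x‖ := by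
        refine add_le_add (add_le_add ?_ (le_trans (Finset.sum_le_sum fun i _ => ?_) b3)) ?_
        · exact ContinuousLinearMap.le_of_opNorm_le _ b1 x
        · exact ContinuousLinearMap.le_opNorm _ _
        · exact ContinuousLinearMap.le_of_opNorm_le _ b2 x
    _ = _ := by ring

end FunctionalCalculus

/-! ### Passage to the adjoint. -/

section Star

theorem star_aeval_eq_aeval_star_map {A : Type*} [Ring A] [StarRing A] [Algebra ℂ A]
    [StarModule ℂ A] (a : A) (p : ℂ[X]) :
    star (aeval a p) = aeval (star a) (p.map (starRingEnd ℂ)) := by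
  induction p using Polynomial.induction_on' with
  | add p q hp hq => rw [map_add, star_add, hp, hq, Polynomial.map_add, map_add]
  | monomial n c =>
    rw [aeval_monomial, map_monomial, aeval_monomial, ← Algebra.smul_def, ← Algebra.smul_def,
      star_smul, star_pow]
    rfl

theorem norm_eval_map_starRingEnd (p : ℂ[X]) (z : ℂ) :
    ‖(p.map (starRingEnd ℂ)).eval z‖ = ‖p.eval (star z)‖ := by
  have h := star_aeval_eq_aeval_star_map (star z) p
  rw [star_star, coe_aeval_eq_eval, coe_aeval_eq_eval] at h
  rw [← h, norm_star]

theorem RittCondition.star {A : Type*} [NormedRing A] [StarRing A] [NormedStarGroup A]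
    [NormedAlgebra ℂ A] [StarModule ℂ A] {a : A} {C : ℝ} (h : RittCondition a C) :
    RittCondition (star a) C where
  mem_resolventSet z hz :=
    spectrum.star_mem_resolventSet_iff.1 (h.mem_resolventSet _ (by rwa [norm_star]))
  norm_le z hz := by
    have e : resolvent (Star.star a) z = Star.star (resolvent a (Star.star z)) := by
      rw [resolvent, resolvent, ← Ring.inverse_star, star_sub, Algebra.algebraMap_eq_smul_one,
        Algebra.algebraMap_eq_smul_one, star_smul, star_star, star_one]
    have := h.norm_le (Star.star z) (by rwa [norm_star])
    rwa [e, norm_star, ← norm_star (z - 1), star_sub, star_one]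

end Star

/-! ### The constants C(T) and c_{1,T}. -/

section Constants

variable {E : Type*} [NormedAddCommGroup E] [NormedSpace ℂ E] {T : E →L[ℂ] E}

theorem IsTadmorRitt.rittCondition (h : IsTadmorRitt T) : RittCondition T (tadmorRittConst T) where
  mem_resolventSet z hz := by
    by_contra hn
    have := h.1 hn
    rw [mem_closedBall_zero_iff] at this
    linarith
  norm_le z hz := by
    rw [← norm_smul]
    exact le_csSup h.2 ⟨z, hz, rfl⟩

variable [CompleteSpace E] [Nontrivial E]

theorem IsTadmorRitt.norm_pow_sub_pow_le_powerDiffBound (h : IsTadmorRitt T) (n : ℕ) :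
    ((n : ℝ) + 1) * ‖T ^ n - T ^ (n + 1)‖ ≤ powerDiffBound T := by
  have key : ∀ n : ℕ, ‖((n : ℂ) + 1) • (T ^ (n + 1) - T ^ n)‖ =
      ((n : ℝ) + 1) * ‖T ^ n - T ^ (n + 1)‖ := by
    intro n
    rw [norm_smul, norm_sub_rev]
    congr 1
    exact_mod_cast Complex.norm_natCast (n + 1)
  rw [← key]
  refine le_ciSup (f := fun n : ℕ => ‖((n : ℂ) + 1) • (T ^ (n + 1) - T ^ n)‖) ?_ n
  -- The real supremum is meaningful only if bounded; the Ritt decay estimate supplies the bound.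
  refine ⟨6 * (1 + tadmorRittConst T) * tadmorRittConst T ^ 2, ?_⟩
  rintro _ ⟨k, rfl⟩
  have := h.rittCondition.norm_mul_pow_sub_pow_le k
  rw [sub_mul, one_mul, ← pow_succ'] at this
  exact (key k).trans_le this

theorem IsTadmorRitt.one_div_eight_le_powerDiffBound (h : IsTadmorRitt T) (hT : T ≠ 1) :
    1 / 8 ≤ powerDiffBound T := by
  by_contra! hc
  refine hT (eq_one_of_norm_dyadic_le ?_ fun i => ?_)
  · have := h.norm_pow_sub_pow_le_powerDiffBound 0
    rw [norm_sub_rev] at this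
    simp at this
    linarith
  · have hN : (0 : ℝ) < (2 ^ i : ℕ) := by positivity
    generalize hNi : 2 ^ i = N at hN
    rw [pow_succ', hNi, pow_sub_pow_two_mul_eq_sum]
    have hb : ∀ k ∈ Finset.Ico N (2 * N), ‖T ^ k - T ^ (k + 1)‖ ≤ 1 / 8 / N := by
      intro k hk
      have h1 := h.norm_pow_sub_pow_le_powerDiffBound k
      have h2 : (N : ℝ) ≤ k := by exact_mod_cast (Finset.mem_Ico.1 hk).1
      rw [le_div_iff₀ hN]
      nlinarith [norm_nonneg (T ^ k - T ^ (k + 1))]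
    refine (norm_sum_le_of_le _ hb).trans (le_of_eq ?_)
    rw [Finset.sum_const, Nat.card_Ico, two_mul, Nat.add_sub_cancel, nsmul_eq_mul]
    field_simp

end Constants

/-! ### Disc norm, adjoint reduction and the final theorem. -/

theorem norm_eval_le_discSupNorm (p : ℂ[X]) {z : ℂ} (hz : ‖z‖ ≤ 1) :
    ‖p.eval z‖ ≤ discSupNorm p := by
  have hcont : Continuous fun z => ‖p.eval z‖ := p.continuous.norm
  have hbdd : BddAbove ((fun z : ℂ => ‖p.eval z‖) '' Metric.ball (0 : ℂ) 1) :=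
    ((isCompact_closedBall (0 : ℂ) 1).bddAbove_image hcont.continuousOn).mono
      (Set.image_mono Metric.ball_subset_closedBall)
  have hsub : Metric.ball (0 : ℂ) 1 ⊆ {z | ‖p.eval z‖ ≤ discSupNorm p} := fun w hw =>
    le_csSup hbdd ⟨w, hw, rfl⟩
  have hclosed : IsClosed {z | ‖p.eval z‖ ≤ discSupNorm p} := isClosed_le hcont continuous_const
  have := closure_minimal hsub hclosed
  rw [closure_ball _ one_ne_zero] at this
  exact this (mem_closedBall_zero_iff.2 hz)

theorem RittCondition.norm_aeval_le_of_squareFunctionEstimate_or_adjoint {H : Type*}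
    [NormedAddCommGroup H] [InnerProductSpace ℂ H] [CompleteSpace H] [Nontrivial H]
    {T : H →L[ℂ] H} {C K : ℝ} (h : RittCondition T C)
    (hK : SquareFunctionEstimate T K ∨ SquareFunctionEstimate (ContinuousLinearMap.adjoint T) K)
    {m n : ℕ} (hmn : m ≤ n) {q : ℂ[X]} {M : ℝ}
    (hn : (X ^ m * q).natDegree ≤ n) (hM : ∀ z : ℂ, ‖z‖ = 1 → ‖q.eval z‖ ≤ M) :
    ‖aeval T (X ^ m * q)‖ ≤ C * (3209 * M) +
      (30 * C + 90 * (1 + C) * C ^ 3) * M * K *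
        Real.sqrt (6 * (1 + Real.log (((n : ℝ) + 2) / ((m : ℝ) + 1)))) := by
  rcases hK with hK | hK
  · exact h.norm_aeval_le_of_squareFunctionEstimate hK hmn hn hM
  · have hmap : (X ^ m * q).map (starRingEnd ℂ) = X ^ m * q.map (starRingEnd ℂ) := by simp
    rw [← norm_star, star_aeval_eq_aeval_star_map, hmap]
    refine RittCondition.norm_aeval_le_of_squareFunctionEstimate h.star hK hmn ?_ fun z hz => ?_
    · rw [← hmap]
      exact natDegree_map_le.trans hn
    · rw [norm_eval_map_starRingEnd]
      exact hM _ (by rwa [norm_star])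

/-- Choosing c as a function before the space and operator expresses that it depends on C(T) only.
-/
theorem theorem3 :
    ∃ c : ℝ → ℝ, (∀ t, 0 < c t) ∧
      ∀ (H : Type u) [NormedAddCommGroup H] [InnerProductSpace ℂ H] [CompleteSpace H]
        (T : H →L[ℂ] H), IsTadmorRitt T → T ≠ 1 →
      ∀ K : ℝ, (SquareFunctionEstimate T K ∨
          SquareFunctionEstimate (ContinuousLinearMap.adjoint T) K) →
      ∀ (m n : ℕ), m ≤ n → ∀ (α : ℕ → ℂ) (p : ℂ[X]),
        p = ∑ j ∈ Finset.Icc m n, C (α j) * X ^ j →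
        ‖aeval T p‖ ≤ constA T * c (tadmorRittConst T) * K * Real.exp (1 / 2) *
          Real.sqrt (constB T + Real.log (((n : ℝ) + 2) / ((m : ℝ) + 1))) * discSupNorm p := by
  -- The 8 comes from 1 ≤ 8K, absorbing the end pieces, and the 3 from √6 ≤ 3; absolute values keep
  -- c positive on all of ℝ. The 8 in 8 D + 1 compensates a ≥ 1/8.
  obtain ⟨D, hD⟩ : ∃ D : ℝ → ℝ, ∀ t,
      D t = 8 * 3209 * |t| + 3 * (30 * |t| + 90 * (1 + |t|) * |t| ^ 3) :=
    ⟨_, fun _ => rfl⟩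
  have hD0 : ∀ t, 0 ≤ D t := fun t => by rw [hD]; positivity
  refine ⟨fun t => 8 * D t + 1, fun t => by linarith [hD0 t], ?_⟩
  intro H _ _ _ T hT hT1 K hK m n hmn α p hp
  have : Nontrivial H := by
    by_contra hH
    rw [not_nontrivial_iff_subsingleton] at hH
    exact hT1 (ContinuousLinearMap.ext fun x => Subsingleton.elim _ _)
  obtain ⟨q, hq⟩ : ∃ q : ℂ[X], p = X ^ m * q := by
    refine ⟨∑ j ∈ Finset.Icc m n, C (α j) * X ^ (j - m), ?_⟩
    rw [hp, Finset.mul_sum]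
    refine Finset.sum_congr rfl fun j hj => ?_
    rw [mul_left_comm, ← pow_add, Nat.add_sub_cancel' (Finset.mem_Icc.1 hj).1]
  have hdeg : p.natDegree ≤ n := by
    rw [hp]
    refine natDegree_sum_le_of_forall_le _ _ fun j hj => ?_
    exact (natDegree_C_mul_X_pow_le _ _).trans (Finset.mem_Icc.1 hj).2
  have hM : ∀ z : ℂ, ‖z‖ = 1 → ‖q.eval z‖ ≤ discSupNorm p := by
    intro z hz
    have := norm_eval_le_discSupNorm p hz.le
    rwa [hq, eval_mul, eval_pow, eval_X, norm_mul, norm_pow, hz, one_pow, one_mul, ← hq] at this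
  have hK8 : 1 / 8 ≤ K := by
    rcases hK with hK | hK
    · exact hK.one_div_eight_le hT1
    · refine hK.one_div_eight_le fun h => hT1 ?_
      rw [← ContinuousLinearMap.adjoint_adjoint T, h]
      exact star_one (H →L[ℂ] H)
  have hR := hT.rittCondition
  have main := hR.norm_aeval_le_of_squareFunctionEstimate_or_adjoint hK hmn (hq ▸ hdeg) hM
  rw [← hq] at main
  have hM0 : 0 ≤ discSupNorm p := (norm_nonneg _).trans (hM 1 norm_one)
  have hc1 := hT.one_div_eight_le_powerDiffBound hT1
  have hL := log_add_two_div_add_one_nonneg hmn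
  have hC0 := hR.nonneg
  have hDC := hD (tadmorRittConst T)
  rw [abs_of_nonneg hC0] at hDC
  generalize Real.log (((n : ℝ) + 2) / ((m : ℝ) + 1)) = L at main hL ⊢
  generalize discSupNorm p = M at main hM0 ⊢
  beta_reduce
  have hD0' := hD0 (tadmorRittConst T)
  generalize D (tadmorRittConst T) = d at hDC hD0' ⊢
  generalize tadmorRittConst T = t at main hC0 hDC
  have hs1 : 1 ≤ Real.sqrt (1 + L) := Real.one_le_sqrt.2 (by linarith)
  have hs2 : Real.sqrt (6 * (1 + L)) ≤ 3 * Real.sqrt (1 + L) := by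
    rw [Real.sqrt_mul (by norm_num)]
    gcongr
    rw [Real.sqrt_le_left (by norm_num)]
    norm_num
  have hs3 : Real.sqrt (1 + L) ≤ Real.sqrt (constB T + L) := by
    refine Real.sqrt_le_sqrt ?_
    rw [constB]
    have : 0 ≤ powerBound T ^ 2 / powerDiffBound T ^ 2 := by positivity
    linarith
  have hA : 1 / 8 ≤ constA T := by
    have h2 : (1 : ℝ) ≤ Real.sqrt 2 := Real.one_le_sqrt.2 (by norm_num)
    rw [constA]
    nlinarith
  have he : 1 ≤ Real.exp (1 / 2) := Real.one_le_exp (by norm_num)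
  have hAc : d ≤ constA T * (8 * d + 1) := by nlinarith
  have hK0 : 0 ≤ K := by linarith
  generalize Real.sqrt (1 + L) = s at hs1 hs2 hs3
  calc ‖aeval T p‖ ≤ t * (3209 * M) + (30 * t + 90 * (1 + t) * t ^ 3) * M * K *
        Real.sqrt (6 * (1 + L)) := main
    _ ≤ t * (3209 * M) * (8 * K * s) + (30 * t + 90 * (1 + t) * t ^ 3) * M * K * (3 * s) := by
        have h1 : 1 ≤ 8 * K * s := by nlinarith
        refine add_le_add (le_mul_of_one_le_right (by positivity) h1) ?_
        gcongr
    _ = d * K * 1 * s * M := by rw [hDC]; ring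
    _ ≤ constA T * (8 * d + 1) * K * Real.exp (1 / 2) * Real.sqrt (constB T + L) * M := by
        gcongr
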